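/- Fix a countably infinite data domain $\mathbb D$, numbered by a bijection with $\mathbb N$, with equality as its only predicate. Traces are infinite sequences $t\in\mathbb D^\omega$; finite traces are words $w\in\mathbb D^*$. **The logic.** cHML$^{\mathrm d}$ formulae are given by $$\varphi ::= \mathsf{tt} \mid \langle b\rangle\varphi \mid \exists x.\varphi \mid \varphi\lor\varphi \mid \varphi\land\varphi \mid \min X.\varphi \mid X,$$ where $b ::= \mathsf{true} \mid e=e \mid \neg b \mid b\land b$ and $e$ is a data variable $x$ or the placeholder $\star$ for the current action. For a data environment $\delta$ (a partial map from data variables to $\mathbb D$) and a map $\rho$ from recursion variables to functions from data environments to sets of traces, the semantics is: $[\![\mathsf{tt},\rho,\delta]\!]=\mathbb D^\omega$; $[\![\langle b\rangle\varphi,\rho,\delta]\!]$ is the set of traces $d\,u$ such that $b$ holds under $\delta[\star\mapsto d]$ and $u\in[\![\varphi,\rho,\delta]\!]$; $[\![\exists x.\varphi,\rho,\delta]\!]=\bigcup_{d\in\mathbb D}[\![\varphi,\rho,\delta[x\mapsto d]]\!]$; $\lor,\land$ are union and intersection; $[\![X,\rho,\delta]\!]=\rho(X)(\delta)$; and $[\![\min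 X.\varphi,\rho,\delta]\!]=F_0(\delta)$, where $F_0$ is the least fixed point of $F\mapsto(\delta'\mapsto[\![\varphi,\rho[X\mapsto F],\delta']\!])$. Formulae are closed, every recursion variable occurs under a modality inside the fixed-point formula that binds it, and no recursion variable is bound twice. For such $\varphi$, $[\![\varphi]\!]$ is the set of traces that satisfy it. **Monitors.** A monitor $m$ consists of predicates $\mathbf{acc}(m,\cdot)$ and $\mathbf{rej}(m,\cdot)$ on finite traces which never hold together and are preserved under extending the finite trace. It rejects $t\in\mathbb D^\omega$ if it rejects some finite prefix of $t$. It is sound for violations for $T\subseteq\mathbb D^\omega$ if it rejects no $t\in T$. It is *violation-optimal* for $T$ if it is sound for violations for $T$ and $\mathbf{rej}(m,w)$ holds for every bad prefix $w$ of $T$ (every $w$ with $w\mathbb D^\omega\cap T=\varnothing$). Given a set $\mathrm{Mon}$ of monitors, $m\in\mathrm{Mon}$ is *optimal for violations in $\mathrm{Mon}$* for $T$ if it is sound for violations for $T$ and rejects every $t\in\mathbb D^\omega$ that is rejected by some $m'\in\mathrm{Mon}$ that is sound for violations for $T$. A program implements $m$ if, on input a finite trace $w$, it outputs the verdict "yes"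 exactly when $\mathbf{acc}(m,w)$ and the verdict "no" exactly when $\mathbf{rej}(m,w)$; it may diverge otherwise. **Theorem.** No effective procedure constructs violation-optimal monitors for cHML$^{\mathrm d}$: there is no partial computable function which maps (the Gödel number of) every closed cHML$^{\mathrm d}$ formula $\varphi$ as above to a program that implements a monitor that is violation-optimal for $[\![\varphi]\!]$. Moreover, for every set $\mathrm{Mon}$ of monitors that contains the monitor rejecting every finite trace (for instance the set of all monitors), there is no partial computable function which maps every such $\varphi$ to a program that implements a monitor that is optimal for violations in $\mathrm{Mon}$ for $[\![\varphi]\!]$. -/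

import Mathlib

namespace CHMLd

/-- Data variables (a countable set of names). -/
abbrev DVar := ℕ

/-- Formula (recursion) variables (a countable set of names). -/
abbrev FVar := ℕ

/-- Expressions: the placeholder `⋆` for the current action, or a data variable. -/
inductive Exp where
  | star : Exp
  | var (x : DVar) : Exp

/-- Boolean constraint expressions, with equality as the only predicate. -/
inductive BExp where
  | tru : BExp
  | eq (e f : Exp) : BExp
  | neg (b : BExp) : BExp
  | conj (b c : BExp) : BExp

/-- Syntax of `cHMLd`: `tt`, `⟨b⟩φ`, `∃x.φ`, `φ ∨ ψ`, `φ ∧ ψ`, `min X.φ` and `X`. -/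
inductive Formula where
  | tt : Formula
  | pos (b : BExp) (φ : Formula) : Formula
  | ex (x : DVar) (φ : Formula) : Formula
  | disj (φ ψ : Formula) : Formula
  | conj (φ ψ : Formula) : Formula
  | min (X : FVar) (φ : Formula) : Formula
  | var (X : FVar) : Formula

/-! ### Variables, closed formulae, guardedness -/

/-- Data variables of an expression. -/
def Exp.vars : Exp → Finset DVar
  | .star => ∅
  | .var x => {x}

/-- Data variables of a constraint. -/
def BExp.vars : BExp → Finset DVar
  | .tru => ∅
  | .eq e f => e.vars ∪ f.vars
  | .neg b => b.vars
  | .conj b c => b.vars ∪ c.vars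

/-- Free data variables; `∃x` binds `x`. -/
def Formula.freeData : Formula → Finset DVar
  | .tt => ∅
  | .pos b φ => b.vars ∪ φ.freeData
  | .ex x φ => φ.freeData.erase x
  | .disj φ ψ => φ.freeData ∪ ψ.freeData
  | .conj φ ψ => φ.freeData ∪ ψ.freeData
  | .min _ φ => φ.freeData
  | .var _ => ∅

/-- Free recursion variables; `min X` binds `X`. -/
def Formula.freeRec : Formula → Finset FVar
  | .tt => ∅
  | .pos _ φ => φ.freeRec
  | .ex _ φ => φ.freeRec
  | .disj φ ψ => φ.freeRec ∪ ψ.freeRec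
  | .conj φ ψ => φ.freeRec ∪ ψ.freeRec
  | .min X φ => φ.freeRec.erase X
  | .var X => {X}

/-- Recursion variables that have a free occurrence outside the scope of every modality. -/
def Formula.unguarded : Formula → Finset FVar
  | .tt => ∅
  | .pos _ _ => ∅
  | .ex _ φ => φ.unguarded
  | .disj φ ψ => φ.unguarded ∪ ψ.unguarded
  | .conj φ ψ => φ.unguarded ∪ ψ.unguarded
  | .min X φ => φ.unguarded.erase X
  | .var X => {X}

/-- Every occurrence of a recursion variable is within the scope of a modal operator inside its
defining fixed-point formula. -/
def Formula.Guarded : Formula → Prop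
  | .tt => True
  | .pos _ φ => φ.Guarded
  | .ex _ φ => φ.Guarded
  | .disj φ ψ => φ.Guarded ∧ ψ.Guarded
  | .conj φ ψ => φ.Guarded ∧ ψ.Guarded
  | .min X φ => X ∉ φ.unguarded ∧ φ.Guarded
  | .var _ => True

/-- The recursion variables bound in a formula, one entry for each binder. -/
def Formula.recBinders : Formula → List FVar
  | .tt => []
  | .pos _ φ => φ.recBinders
  | .ex _ φ => φ.recBinders
  | .disj φ ψ => φ.recBinders ++ ψ.recBinders
  | .conj φ ψ => φ.recBinders ++ ψ.recBinders
  | .min X φ => X :: φ.recBinders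
  | .var _ => []

/-- The closed formulae, with the usual conventions: recursion is guarded and no recursion variable
is bound twice. -/
structure Formula.WellFormed (φ : Formula) : Prop where
  closedData : φ.freeData = ∅
  closedRec : φ.freeRec = ∅
  guarded : φ.Guarded
  bindsOnce : φ.recBinders.Nodup

/-! ### Linear-time semantics over the data domain `D` -/

section Semantics

variable {D : Type*}

/-- Data environments: partial functions from data variables to data values. -/
abbrev DEnv (D : Type*) := DVar → Option D

/-- Infinite traces. Finite traces are lists. -/
abbrev Trace (D : Type*) := ℕ → D

/-- Data interpretations. -/
abbrev DInt (D : Type*) := DEnv D → Set (Trace D)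

/-- Trace environments. -/
abbrev TEnv (D : Type*) := FVar → DInt D

/-- Value of an expression when the current action is `d`. -/
def Exp.val (δ : DEnv D) (d : D) : Exp → Option D
  | .star => some d
  | .var x => δ x

/-- The constraint evaluates to true under `δ[⋆ ↦ d]`. (Only used when all its variables are in
the domain of `δ`.) -/
def BExp.Holds (δ : DEnv D) (d : D) : BExp → Prop
  | .tru => True
  | .eq e f => e.val δ d = f.val δ d
  | .neg b => ¬ b.Holds δ d
  | .conj b c => b.Holds δ d ∧ c.Holds δ d

/-- The denotation of a formula under a trace environment and a data environment. The least fixed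
point is the meet of the pre-fixed points in the pointwise order on data interpretations. -/
def Formula.den : Formula → TEnv D → DEnv D → Set (Trace D)
  | .tt, _, _ => Set.univ
  | .pos b φ, ρ, δ => {t | b.Holds δ (t 0) ∧ (fun n => t (n + 1)) ∈ φ.den ρ δ}
  | .ex x φ, ρ, δ => ⋃ d : D, φ.den ρ (Function.update δ x (some d))
  | .disj φ ψ, ρ, δ => φ.den ρ δ ∪ ψ.den ρ δ
  | .conj φ ψ, ρ, δ => φ.den ρ δ ∩ ψ.den ρ δ
  | .min X φ, ρ, δ =>
      ⋂ (F : DInt D) (_ : ∀ δ', φ.den (Function.update ρ X F) δ' ⊆ F δ'), F δ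
  | .var X, ρ, δ => ρ X δ

/-- The set of traces satisfying a closed formula, computed in the empty environments. -/
def Formula.traces (D : Type*) (φ : Formula) : Set (Trace D) :=
  φ.den (fun _ _ => ∅) (fun _ => none)

end Semantics

/-! ### Monitors -/

section Monitors

variable {D : Type*}

/-- A monitor: consistent and irrevocable acceptance and rejection predicates on finite traces. -/
structure Monitor (D : Type*) where
  acc : List D → Prop
  rej : List D → Prop
  consistent : ∀ w, ¬ (acc w ∧ rej w)
  acc_irrevocable : ∀ w y, w <+: y → acc w → acc y
  rej_irrevocable : ∀ w y, w <+: y → rej w → rej y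

/-- The finite trace made of the first `n` values of `t`. -/
def initSeg (t : Trace D) (n : ℕ) : List D := (List.range n).map t

/-- The monitor rejects the infinite trace `t`: it rejects one of its finite initial segments. -/
def Monitor.Rejects (m : Monitor D) (t : Trace D) : Prop := ∃ n, m.rej (initSeg t n)

/-- Soundness for violations. -/
def Monitor.SoundForViolations (m : Monitor D) (T : Set (Trace D)) : Prop :=
  ∀ t, m.Rejects t → t ∉ T

/-- `w` is a bad prefix for `T`: no infinite extension of `w` belongs to `T`. -/
def IsBadPrefix (T : Set (Trace D)) (w : List D) : Prop :=
  ∀ t : Trace D, initSeg t w.length = w → t ∉ T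

/-- Violation-optimality: the monitor is sound for violations and rejects every bad prefix. -/
def Monitor.ViolationOptimal (m : Monitor D) (T : Set (Trace D)) : Prop :=
  m.SoundForViolations T ∧ ∀ w, IsBadPrefix T w → m.rej w

/-- Optimality for violations relative to a set `Mon` of monitors: the monitor is in `Mon`, is
sound for violations, and rejects every infinite trace that some monitor of `Mon` which is sound
for violations rejects. -/
def Monitor.OptimalForViolationsIn (Mon : Set (Monitor D)) (m : Monitor D)
    (T : Set (Trace D)) : Prop :=
  m ∈ Mon ∧ m.SoundForViolations T ∧
    ∀ m' ∈ Mon, m'.SoundForViolations T → ∀ t, m'.Rejects t → m.Rejects t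

/-- The monitor that rejects every finite trace. -/
def Monitor.rejectAll (D : Type*) : Monitor D where
  acc _ := False
  rej _ := True
  consistent _ h := h.1
  acc_irrevocable _ _ _ h := h
  rej_irrevocable _ _ _ _ := trivial

end Monitors

/-! ### Effective constructions -/

/-- Number of an expression. -/
def Exp.num : Exp → ℕ
  | .star => 0
  | .var x => x + 1

/-- Gödel number of a constraint. -/
def BExp.num : BExp → ℕ
  | .tru => Nat.pair 0 0
  | .eq e f => Nat.pair 1 (Nat.pair e.num f.num)
  | .neg b => Nat.pair 2 b.num
  | .conj b c => Nat.pair 3 (Nat.pair b.num c.num)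

/-- Gödel number of a formula. -/
def Formula.num : Formula → ℕ
  | .tt => Nat.pair 0 0
  | .pos b φ => Nat.pair 1 (Nat.pair b.num φ.num)
  | .ex x φ => Nat.pair 2 (Nat.pair x φ.num)
  | .disj φ ψ => Nat.pair 3 (Nat.pair φ.num ψ.num)
  | .conj φ ψ => Nat.pair 4 (Nat.pair φ.num ψ.num)
  | .min X φ => Nat.pair 5 (Nat.pair X φ.num)
  | .var X => Nat.pair 6 X

theorem Exp.num_injective : Function.Injective Exp.num := by
  intro a b h
  cases a <;> cases b <;> simp_all [Exp.num]

theorem BExp.num_injective : Function.Injective BExp.num := by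
  intro a
  induction a with
  | tru => intro b' h; cases b' <;> simp_all [BExp.num, Nat.pair_eq_pair]
  | eq e f =>
    intro b' h
    cases b' <;> simp_all [BExp.num, Nat.pair_eq_pair, Exp.num_injective.eq_iff]
  | neg b ih =>
    intro b' h
    cases b' <;> simp [BExp.num, Nat.pair_eq_pair] at h ⊢
    exact ih h
  | conj b c ihb ihc =>
    intro b' h
    cases b' <;> simp [BExp.num, Nat.pair_eq_pair] at h ⊢
    exact ⟨ihb h.1, ihc h.2⟩

theorem Formula.num_injective : Function.Injective Formula.num := by
  intro a
  induction a with
  | tt => intro b h; cases b <;> simp_all [Formula.num, Nat.pair_eq_pair]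
  | var X => intro b h; cases b <;> simp_all [Formula.num, Nat.pair_eq_pair]
  | pos c φ ih =>
    intro b h
    cases b <;> simp [Formula.num, Nat.pair_eq_pair] at h ⊢
    exact ⟨BExp.num_injective h.1, ih h.2⟩
  | ex x φ ih =>
    intro b h
    cases b <;> simp [Formula.num, Nat.pair_eq_pair] at h ⊢
    exact ⟨h.1, ih h.2⟩
  | min x φ ih =>
    intro b h
    cases b <;> simp [Formula.num, Nat.pair_eq_pair] at h ⊢
    exact ⟨h.1, ih h.2⟩
  | disj φ ψ ih₁ ih₂ =>
    intro b h
    cases b <;> simp [Formula.num, Nat.pair_eq_pair] at h ⊢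
    exact ⟨ih₁ h.1, ih₂ h.2⟩
  | conj φ ψ ih₁ ih₂ =>
    intro b h
    cases b <;> simp [Formula.num, Nat.pair_eq_pair] at h ⊢
    exact ⟨ih₁ h.1, ih₂ h.2⟩

/-- The program `c` implements the monitor `m`: run on (the number of) a finite trace `w`, it
outputs `1` exactly when `m` accepts `w` and `0` exactly when `m` rejects `w`. It may diverge, or
output another number, when `m` has no verdict on `w`. -/
def Implements {D : Type*} [Denumerable D] (c : Nat.Partrec.Code) (m : Monitor D) : Prop :=
  ∀ w : List D,
    (m.acc w ↔ 1 ∈ c.eval (Encodable.encode w)) ∧ (m.rej w ↔ 0 ∈ c.eval (Encodable.encode w))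

/-- There is an effective procedure which, from any closed `cHMLd` formula `φ`, constructs
(a program for) a monitor `m` such that `P m T`, where `T` is the set of traces satisfying `φ`. -/
def EffectivelyConstructible (D : Type*) [Denumerable D]
    (P : Monitor D → Set (Trace D) → Prop) : Prop :=
  ∃ f : ℕ →. Nat.Partrec.Code, Partrec f ∧
    ∀ φ : Formula, φ.WellFormed →
      ∃ c ∈ f φ.num, ∃ m : Monitor D, Implements c m ∧ P m (φ.traces D)

end CHMLd

namespace CHMLd

variable {D : Type*}

/-! The proof reduces non-halting, which is not recursively enumerable, to rejection by the
constructed monitors. For a program with number `n`, a formula is computed that is satisfiable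
exactly when the program halts on 0. If it is satisfiable, it is satisfied by one computable trace,
`blockTrace`, which depends on `n` only. If the program halts, a sound monitor never rejects this
trace. If it does not halt, the formula denotes the empty set, and a monitor of either kind rejects
every trace. Rejection of a prefix of a computable trace can be searched for, so non-halting would
be recursively enumerable (`not_effectivelyConstructible`).

The formula guesses values `z` (zero) and `e` (end marker) and reads the part of the trace before
the first `e` as a finite successor table: consecutive values `x`, `y` with `y ≠ z` mean that `y` is
the successor of `x`. The end marker bounds the part to inspect, so least fixed points suffice to
check that the table is injective (`Valid`). A value then represents at most one number. The formula
forces the value at position `n` to represent `n`, and asks for a value before `e`, representing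
some `k`, such that a primitive recursive `h` has `h (n, k) = 0`, where `h` tests halting within
fuel `k` (`exists_formula`).

Graphs of primitive recursive functions are definable by induction on the function
(`FunDefinable.of_primrec`); primitive recursion is a least fixed point whose data are passed in
registers. Exact definability fails, since a given trace may contain too few pairs, or lack them at
later positions. Hence `Definable` only places a formula between a soundness condition, valid on
every trace, and a completeness condition, which assumes that the trace repeats the needed pairs
often enough. -/

theorem Formula.unguarded_subset_freeRec (φ : Formula) : φ.unguarded ⊆ φ.freeRec := by
  induction φ with
  | tt => simp [Formula.unguarded]
  | pos b φ ih => simp [Formula.unguarded]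
  | ex x φ ih => exact ih
  | disj φ ψ h₁ h₂ => exact Finset.union_subset_union h₁ h₂
  | conj φ ψ h₁ h₂ => exact Finset.union_subset_union h₁ h₂
  | min X φ ih => exact Finset.erase_subset_erase _ ih
  | var X => exact subset_rfl

/-! ### Closure properties of definable predicates. -/

/-- The suffix of a trace that starts at position `i`. -/
def Trace.drop (t : Trace D) (i : ℕ) : Trace D := fun n => t (n + i)

@[simp] theorem Trace.drop_apply (t : Trace D) (i n : ℕ) : t.drop i n = t (n + i) := rfl

theorem Trace.drop_zero (t : Trace D) : t.drop 0 = t := rfl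

theorem Trace.drop_drop (t : Trace D) (i j : ℕ) : (t.drop i).drop j = t.drop (i + j) := by
  funext n
  simp only [Trace.drop_apply]
  congr 1
  omega

/-- Syntactic side conditions: all free data variables are in `V`, no free recursion variable,
guarded recursion, and distinct binders, all of which are at least `k`. -/
structure Formula.Clean (V : Finset DVar) (k : ℕ) (φ : Formula) : Prop where
  freeData : φ.freeData ⊆ V
  freeRec : φ.freeRec = ∅
  guarded : φ.Guarded
  nodup : φ.recBinders.Nodup
  le : ∀ X ∈ φ.recBinders, k ≤ X

theorem Formula.Clean.unguarded {V k} {φ : Formula} (h : φ.Clean V k) : φ.unguarded = ∅ :=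
  Finset.subset_empty.1 (h.freeRec ▸ φ.unguarded_subset_freeRec)

theorem exists_forall_mem_lt (l : List ℕ) (k : ℕ) : ∃ k', k ≤ k' ∧ ∀ X ∈ l, X < k' := by
  induction l with
  | nil => exact ⟨k, le_rfl, by simp⟩
  | cons a l ih =>
    obtain ⟨k', h, h'⟩ := ih
    refine ⟨max k' (a + 1), h.trans (le_max_left _ _), ?_⟩
    intro X hX
    rcases List.mem_cons.1 hX with rfl | hX
    · exact lt_of_lt_of_le (Nat.lt_succ_self _) (le_max_right _ _)
    · exact (h' X hX).trans_le (le_max_left _ _)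

/-- There are formulae with free data variables in `V`, and with recursion variables as large as
we want, whose denotation lies between `Cmp` and `Snd`. -/
def Definable (V : Finset DVar) (Snd Cmp : DEnv D → Trace D → Prop) : Prop :=
  ∀ k : ℕ, ∃ φ : Formula, φ.Clean V k ∧
    ∀ ρ δ t, (t ∈ φ.den ρ δ → Snd δ t) ∧ (Cmp δ t → t ∈ φ.den ρ δ)

namespace Definable

variable {V W : Finset DVar} {S S' C C' : DEnv D → Trace D → Prop}

theorem mono (h : Definable V S C) (hV : V ⊆ W) (hS : ∀ δ t, S δ t → S' δ t)
    (hC : ∀ δ t, C' δ t → C δ t) : Definable W S' C' := by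
  intro k
  obtain ⟨φ, h₁, h₂⟩ := h k
  exact ⟨φ, { h₁ with freeData := h₁.freeData.trans hV }, fun ρ δ t =>
    ⟨fun h => hS _ _ ((h₂ ρ δ t).1 h), fun h => (h₂ ρ δ t).2 (hC _ _ h)⟩⟩

theorem tt : Definable V (fun (_ : DEnv D) _ => True) (fun _ _ => True) := by
  intro k
  refine ⟨.tt, ⟨by simp [Formula.freeData], rfl, trivial, List.nodup_nil, ?_⟩, ?_⟩
  · simp [Formula.recBinders]
  · simp [Formula.den]

theorem pos (b : BExp) (hb : b.vars ⊆ V) (h : Definable V S C) :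
    Definable V (fun δ t => b.Holds δ (t 0) ∧ S δ (t.drop 1))
      (fun δ t => b.Holds δ (t 0) ∧ C δ (t.drop 1)) := by
  intro k
  obtain ⟨φ, h₁, h₂⟩ := h k
  exact ⟨.pos b φ, { h₁ with freeData := Finset.union_subset hb h₁.freeData }, fun ρ δ t =>
    ⟨fun h => ⟨h.1, (h₂ ρ δ _).1 h.2⟩, fun h => ⟨h.1, (h₂ ρ δ _).2 h.2⟩⟩⟩

theorem test (b : BExp) (hb : b.vars ⊆ V) :
    Definable V (fun (δ : DEnv D) t => b.Holds δ (t 0)) (fun δ t => b.Holds δ (t 0)) :=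
  (pos b hb tt).mono subset_rfl (fun _ _ h => h.1) (fun _ _ h => ⟨h, trivial⟩)

/-- The bound `k` in `Definable` serves here: the second formula is chosen with binders above all
those of the first, so no recursion variable is bound twice. -/
theorem conj (h : Definable V S C) (h' : Definable V S' C') :
    Definable V (fun δ t => S δ t ∧ S' δ t) (fun δ t => C δ t ∧ C' δ t) := by
  intro k
  obtain ⟨φ, h₁, h₂⟩ := h k
  obtain ⟨k', hk, hk'⟩ := exists_forall_mem_lt φ.recBinders k
  obtain ⟨ψ, h₃, h₄⟩ := h' k'
  refine ⟨.conj φ ψ, ⟨Finset.union_subset h₁.freeData h₃.freeData, ?_, ⟨h₁.guarded, h₃.guarded⟩,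
    h₁.nodup.append h₃.nodup fun X hX hX' => ?_, fun X hX => ?_⟩, fun ρ δ t =>
    ⟨fun h => ⟨(h₂ ρ δ _).1 h.1, (h₄ ρ δ _).1 h.2⟩, fun h => ⟨(h₂ ρ δ _).2 h.1, (h₄ ρ δ _).2 h.2⟩⟩⟩
  · simp [Formula.freeRec, h₁.freeRec, h₃.freeRec]
  · exact absurd (hk' X hX) (not_lt.2 (h₃.le X hX'))
  · rcases List.mem_append.1 hX with hX | hX
    exacts [h₁.le X hX, hk.trans (h₃.le X hX)]

theorem conjList {ι : Type*} {S C : ι → DEnv D → Trace D → Prop} (l : List ι)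
    (h : ∀ i ∈ l, Definable V (S i) (C i)) :
    Definable V (fun δ t => ∀ i ∈ l, S i δ t) (fun δ t => ∀ i ∈ l, C i δ t) := by
  induction l with
  | nil => exact tt.mono subset_rfl (by simp) (by simp)
  | cons a l ih =>
    exact ((h a (by simp)).conj (ih fun i hi => h i (by simp [hi]))).mono subset_rfl
      (by simp) (by simp)

theorem ex (x : DVar) (h : Definable (insert x V) S C) :
    Definable V (fun δ t => ∃ d, S (Function.update δ x (some d)) t)
      (fun δ t => ∃ d, C (Function.update δ x (some d)) t) := by
  intro k
  obtain ⟨φ, h₁, h₂⟩ := h k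
  refine ⟨.ex x φ, { h₁ with freeData := ?_ }, fun ρ δ t => ?_⟩
  · simpa [Formula.freeData, Finset.subset_insert_iff] using h₁.freeData
  · simp only [Formula.den, Set.mem_iUnion]
    exact ⟨fun ⟨d, h⟩ => ⟨d, (h₂ _ _ _).1 h⟩, fun ⟨d, h⟩ => ⟨d, (h₂ _ _ _).2 h⟩⟩

theorem exList (l : List DVar) (h : Definable (l.toFinset ∪ V) S C) :
    Definable V (fun δ t => ∃ δ' : DEnv D, (∀ x ∉ l, δ' x = δ x) ∧ S δ' t)
      -- Completeness has to demand values in `l`, since a quantifier never leaves its variable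
      -- undefined.
      (fun δ t => ∃ δ' : DEnv D, (∀ x ∉ l, δ' x = δ x) ∧ (∀ x ∈ l, (δ' x).isSome) ∧ C δ' t) := by
  induction l generalizing V S C with
  | nil =>
    refine h.mono (by simp) (fun δ t h => ⟨δ, by simp, h⟩) ?_
    rintro δ t ⟨δ', h₁, -, h₂⟩
    rwa [show δ = δ' from funext fun x => (h₁ x (by simp)).symm]
  | cons a l ih =>
    refine (ex a (ih (V := insert a V) (h.mono ?_ (fun _ _ h => h) (fun _ _ h => h)))).mono
      subset_rfl ?_ ?_
    · intro x
      simp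
    · rintro δ t ⟨d, δ', h₁, h₂⟩
      refine ⟨δ', fun x hx => ?_, h₂⟩
      simp only [List.mem_cons, not_or] at hx
      rw [h₁ x hx.2, Function.update_of_ne hx.1]
    · rintro δ t ⟨δ', h₁, h₂, h₃⟩
      obtain ⟨d, hd⟩ := Option.isSome_iff_exists.1 (h₂ a (by simp))
      refine ⟨d, δ', fun x hx => ?_, fun x hx => h₂ x (by simp [hx]), h₃⟩
      by_cases hxa : x = a
      · subst hxa
        rw [hd, Function.update_self]
      · rw [h₁ x (by simp [hxa, hx]), Function.update_of_ne hxa]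


/-- This is the until operator, `min X. ψ ∨ (φ ∧ ⟨true⟩X)`. Soundness holds because the intended
predicate is a pre-fixed point, completeness by induction on the waiting time. -/
theorem eventually {S₁ C₁ S₂ C₂ : DEnv D → Trace D → Prop} (h : Definable V S₁ C₁)
    (h' : Definable V S₂ C₂) :
    Definable V (fun δ t => ∃ i, (∀ j < i, S₁ δ (t.drop j)) ∧ S₂ δ (t.drop i))
      (fun δ t => ∃ i, (∀ j < i, C₁ δ (t.drop j)) ∧ C₂ δ (t.drop i)) := by
  intro k
  -- The variable `k` itself is reserved for the new binder.
  obtain ⟨φ, h₁, h₂⟩ := h (k + 1)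
  obtain ⟨k', hk, hk'⟩ := exists_forall_mem_lt φ.recBinders (k + 1)
  obtain ⟨ψ, h₃, h₄⟩ := h' k'
  refine ⟨.min k (.disj ψ (.conj φ (.pos .tru (.var k)))), ⟨?_, ?_, ?_, ?_, ?_⟩,
    fun ρ δ t => ⟨?_, ?_⟩⟩
  · simp [Formula.freeData, BExp.vars, Finset.union_subset_iff, h₁.freeData, h₃.freeData]
  · simp [Formula.freeRec, h₁.freeRec, h₃.freeRec]
  · simp [Formula.Guarded, Formula.unguarded, h₁.unguarded, h₃.unguarded, h₁.guarded, h₃.guarded]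
  · simp only [Formula.recBinders, List.append_nil, List.nodup_cons, List.mem_append, not_or]
    refine ⟨⟨fun hX => ?_, fun hX => ?_⟩, h₃.nodup.append h₁.nodup fun X hX hX' => ?_⟩
    · have := h₃.le _ hX
      omega
    · have := h₁.le _ hX
      omega
    · have := h₃.le _ hX
      have := hk' _ hX'
      omega
  · simp only [Formula.recBinders, List.append_nil, List.mem_cons, List.mem_append]
    rintro X (rfl | hX | hX)
    · exact le_rfl
    · have := h₃.le _ hX
      omega
    · have := h₁.le _ hX
      omega
  · intro ht
    simp only [Formula.den, Set.mem_iInter] at ht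
    refine ht (fun δ => {t | ∃ i, (∀ j < i, S₁ δ (t.drop j)) ∧ S₂ δ (t.drop i)}) fun δ' t' ht' => ?_
    rcases ht' with ht' | ⟨ht', -, ht''⟩
    · exact ⟨0, by simp, (h₄ _ _ _).1 ht'⟩
    · rw [Function.update_self] at ht''
      obtain ⟨i, hi, hi'⟩ := ht''
      refine ⟨i + 1, fun j hj => ?_, ?_⟩
      · cases j with
        | zero => exact (h₂ _ _ _).1 ht'
        | succ j => exact hi j (by omega)
      · exact hi'
  · rintro ⟨i, hi, hi'⟩
    simp only [Formula.den, Set.mem_iInter]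
    intro F hF
    induction i generalizing t with
    | zero => exact hF _ (Or.inl ((h₄ _ _ _).2 hi'))
    | succ i ih =>
      refine hF _ (Or.inr ⟨(h₂ _ _ _).2 (hi 0 (by omega)), trivial, ?_⟩)
      rw [Function.update_self]
      refine ih (t.drop 1) (fun j hj => ?_) ?_
      · rw [Trace.drop_drop, Nat.add_comm]
        exact hi _ (by omega)
      · rw [Trace.drop_drop, Nat.add_comm]
        exact hi'

end Definable

/-! ### Recursion with registers. -/

/-- The predicate on data environments and traces that is generated by `P` and by a recursion in
which the registers `a` and `r` get the values guessed for `b` and `q` while the trace advances by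
one position. -/
inductive Iter (a r b q : DVar) (P Q : DEnv D → Trace D → Prop) : DEnv D → Trace D → Prop
  | base {δ t} : P δ t → Iter a r b q P Q δ t
  | step {δ t} (d d' : D) :
      Q (Function.update (Function.update δ b (some d)) q (some d')) t →
      Iter a r b q P Q (Function.update (Function.update (Function.update (Function.update δ
        b (some d)) q (some d')) a (some d)) r (some d')) (t.drop 1) →
      Iter a r b q P Q δ t

/-- A recursion variable takes no arguments but is evaluated in the current data environment. The
assignment `a := b` is therefore written as `∃ a. a = b ∧ …`, and likewise `r := q`. The modality
before the recursive call provides guardedness, at the price of one trace position per call. -/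
theorem Definable.iter {V : Finset DVar} {S₁ C₁ S₂ C₂ : DEnv D → Trace D → Prop} {a r b q : DVar}
    (hab : a ≠ b) (hbq : b ≠ q) (haq : a ≠ q) (hrq : r ≠ q)
    (h : Definable (insert a (insert r V)) S₁ C₁)
    (h' : Definable (insert b (insert q (insert a (insert r V)))) S₂ C₂) :
    Definable (insert a (insert r V)) (Iter a r b q S₁ S₂) (Iter a r b q C₁ C₂) := by
  intro k
  obtain ⟨φ, h₁, h₂⟩ := h (k + 1)
  obtain ⟨k', hk, hk'⟩ := exists_forall_mem_lt φ.recBinders (k + 1)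
  obtain ⟨ψ, h₃, h₄⟩ := h' k'
  refine ⟨.min k (.disj φ (.ex b (.ex q (.conj ψ (.ex a (.conj
    (.pos (.eq (.var a) (.var b)) .tt) (.ex r (.conj (.pos (.eq (.var r) (.var q)) .tt)
      (.pos .tru (.var k)))))))))), ⟨?_, ?_, ?_, ?_, ?_⟩, fun ρ δ t => ⟨?_, ?_⟩⟩
  · have h1 := h₁.freeData
    have h3 := h₃.freeData
    intro x hx
    simp only [Formula.freeData, BExp.vars, Exp.vars, Finset.mem_union, Finset.mem_erase,
      Finset.mem_singleton, Finset.notMem_empty] at hx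
    rcases hx with hx | ⟨hx, hx', hx'' | hx''⟩
    · exact h1 hx
    · have := h3 hx''
      simp only [Finset.mem_insert] at this ⊢
      tauto
    · tauto
  · simp [Formula.freeRec, h₁.freeRec, h₃.freeRec]
  · simp [Formula.Guarded, Formula.unguarded, h₁.unguarded, h₃.unguarded, h₁.guarded, h₃.guarded]
  · simp only [Formula.recBinders, List.append_nil, List.nodup_cons,
      List.mem_append, not_or]
    refine ⟨⟨fun hX => ?_, fun hX => ?_⟩, h₁.nodup.append h₃.nodup fun X hX hX' => ?_⟩
    · have := h₁.le _ hX
      omega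
    · have := h₃.le _ hX
      omega
    · have := h₃.le _ hX'
      have := hk' _ hX
      omega
  · simp only [Formula.recBinders, List.append_nil, List.mem_cons,
      List.mem_append]
    rintro X (rfl | hX | hX)
    · exact le_rfl
    · have := h₁.le _ hX
      omega
    · have := h₃.le _ hX
      omega
  · intro ht
    simp only [Formula.den, Set.mem_iInter] at ht
    refine ht (fun δ => {t | Iter a r b q S₁ S₂ δ t}) fun δ' t' ht' => ?_
    rcases ht' with ht' | ht'
    · exact Iter.base ((h₂ _ _ _).1 ht')
    · simp only [Set.mem_iUnion] at ht'
      obtain ⟨d, d', ht', ht''⟩ := ht'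
      simp only [Set.mem_iUnion] at ht''
      obtain ⟨d₁, ⟨hd₁, -⟩, ht''⟩ := ht''
      simp only [Set.mem_iUnion] at ht''
      obtain ⟨d₂, ⟨hd₂, -⟩, -, ht''⟩ := ht''
      simp only [BExp.Holds, Exp.val, Function.update_self, Function.update_of_ne, ne_eq,
        hab.symm, hbq, not_false_eq_true, Option.some.injEq] at hd₁
      simp only [BExp.Holds, Exp.val, Function.update_self, Function.update_of_ne, ne_eq,
        haq.symm, hrq.symm, not_false_eq_true, Option.some.injEq] at hd₂
      subst hd₁ hd₂
      rw [Function.update_self] at ht''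
      exact Iter.step _ _ ((h₄ _ _ _).1 ht') ht''
  · intro ht
    simp only [Formula.den, Set.mem_iInter]
    intro F hF
    induction ht with
    | base ht => exact hF _ (Or.inl ((h₂ _ _ _).2 ht))
    | step d d' ht ht' ih =>
      refine hF _ (Or.inr ?_)
      simp only [Set.mem_iUnion]
      refine ⟨d, d', (h₄ _ _ _).2 ht, ?_⟩
      simp only [Set.mem_iUnion]
      refine ⟨d, ⟨?_, trivial⟩, ?_⟩
      · simp [BExp.Holds, Exp.val, Function.update_of_ne, hab.symm, hbq]
      simp only [Set.mem_iUnion]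
      refine ⟨d', ⟨?_, trivial⟩, trivial, ?_⟩
      · simp [BExp.Holds, Exp.val, Function.update_of_ne, haq.symm, hrq.symm]
      rw [Function.update_self]
      exact ih

/-! ### Numbers coded by the consecutive pairs of a trace. -/

/-- The values `x` and `y ≠ z` are consecutive in the trace `t`, before the first `e`. -/
def Edge (z e : D) (t : Trace D) (x y : D) : Prop :=
  ∃ i, t i = x ∧ t (i + 1) = y ∧ (∀ j ≤ i + 1, t j ≠ e) ∧ y ≠ z

theorem Edge.of_drop {z e x y : D} {t : Trace D} {n : ℕ} (h : Edge z e (t.drop n) x y)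
    (ht : ∀ j < n, t j ≠ e) : Edge z e t x y := by
  obtain ⟨i, h₁, h₂, h₃, h₄⟩ := h
  refine ⟨i + n, h₁, ?_, fun j hj => ?_, h₄⟩
  · rw [← h₂, Trace.drop_apply]
    congr 1
    omega
  · rcases lt_or_ge j n with hjn | hjn
    · exact ht j hjn
    · have := h₃ (j - n) (by omega)
      rwa [Trace.drop_apply, Nat.sub_add_cancel hjn] at this

/-- `S` is an injective relation whose range does not contain `z`. -/
structure IsSucc (z : D) (S : D → D → Prop) : Prop where
  injective : ∀ {x x' y}, S x y → S x' y → x = x'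
  ne_zero : ∀ {x y}, S x y → y ≠ z

/-- The value `d` is the `n`-th successor of `z`. -/
def Rep (z : D) (S : D → D → Prop) : ℕ → D → Prop
  | 0, d => d = z
  | n + 1, d => ∃ b, Rep z S n b ∧ S b d

/-- The constraint saying that the current action is not the end marker, kept in register `1`. -/
def BExp.notEnd : BExp := .neg (.eq .star (.var 1))

theorem BExp.notEnd_holds {δ : DEnv D} {d e : D} (h : δ 1 = some e) :
    BExp.notEnd.Holds δ d ↔ d ≠ e := by
  simp [BExp.notEnd, BExp.Holds, Exp.val, h]

/-- The constraint saying that the current action is not zero, kept in register `0`. -/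
def BExp.notZero : BExp := .neg (.eq .star (.var 0))

theorem BExp.notZero_holds {δ : DEnv D} {d z : D} (h : δ 0 = some z) :
    BExp.notZero.Holds δ d ↔ d ≠ z := by
  simp [BExp.notZero, BExp.Holds, Exp.val, h]

/-- `Edge` for the values of the registers `b` and `a`. -/
def EdgeReg (b a : DVar) (δ : DEnv D) (t : Trace D) : Prop :=
  ∀ z e, δ 0 = some z → δ 1 = some e → ∃ x y, δ b = some x ∧ δ a = some y ∧ Edge z e t x y

/-- The registers `0` and `1` have values. -/
def HasEnds (δ : DEnv D) : Prop := ∃ z e, δ 0 = some z ∧ δ 1 = some e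

theorem Definable.notEnd : Definable {0, 1} (fun (δ : DEnv D) t => ∀ e, δ 1 = some e → t 0 ≠ e)
    (fun δ t => ∃ e, δ 1 = some e ∧ t 0 ≠ e) :=
  (Definable.test BExp.notEnd (by decide)).mono subset_rfl
    (fun _ _ h _ he => (BExp.notEnd_holds he).1 h)
    (fun _ _ ⟨_, he, h⟩ => (BExp.notEnd_holds he).2 h)

theorem Definable.eq (x y : DVar) :
    Definable {x, y} (fun (δ : DEnv D) _ => δ x = δ y) (fun δ _ => δ x = δ y) :=
  Definable.test (.eq (.var x) (.var y)) (by
    intro z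
    simp [BExp.vars, Exp.vars])

theorem Definable.edge (b a : DVar) :
    Definable {0, 1, b, a} (EdgeReg b a) (fun (δ : DEnv D) t => HasEnds δ ∧ EdgeReg b a δ t) := by
  have h₁ : Definable {0, 1, b, a} _ _ :=
    (Definable.test (D := D) (.conj (.eq .star (.var a)) (.conj .notEnd .notZero))
      (V := {0, 1, b, a}) (by
        intro x
        simp [BExp.vars, Exp.vars, BExp.notEnd, BExp.notZero]
        tauto)).pos (.conj (.eq .star (.var b)) .notEnd) (by
        intro x
        simp [BExp.vars, Exp.vars, BExp.notEnd]
        tauto)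
  refine ((Definable.notEnd.mono (by intro x; simp; tauto) (fun _ _ h => h)
    (fun _ _ h => h)).eventually h₁).mono subset_rfl ?_ ?_
  · rintro δ t ⟨i, hi, ⟨hb, hb'⟩, ha, ha', ha''⟩ z e hz he
    refine ⟨_, _, Eq.symm hb, Eq.symm ha, i, by simp, by simp [Nat.add_comm], fun j hj => ?_, ?_⟩
    · rcases Nat.lt_or_ge j i with h | h
      · simpa using hi j h e he
      · obtain rfl | rfl : j = i ∨ j = i + 1 := by omega
        · simpa using (BExp.notEnd_holds he).1 hb'
        · simpa [Nat.add_comm] using (BExp.notEnd_holds he).1 ha'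
    · exact (BExp.notZero_holds hz).1 ha''
  · rintro δ t ⟨⟨z, e, hz, he⟩, h⟩
    obtain ⟨x, y, hx, hy, i, rfl, rfl, h₁, h₂⟩ := h z e hz he
    refine ⟨i, fun j hj => ⟨e, he, ?_⟩, ⟨?_, ?_⟩, ?_, ?_, ?_⟩
    · simpa using h₁ j (by omega)
    · simpa [BExp.Holds, Exp.val] using hx.symm
    · simpa [BExp.notEnd_holds he] using h₁ i (by omega)
    · simpa [BExp.Holds, Exp.val, Nat.add_comm] using hy.symm
    · simpa [BExp.notEnd_holds he, Nat.add_comm] using h₁ (i + 1) (by omega)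
    · simpa [BExp.notZero_holds hz, Nat.add_comm] using h₂

/-! ### Definability of primitive recursive functions. -/

/-- For every successor relation which contains the consecutive pairs of the trace, if the
registers `v` represent `ns`, then `y` represents `f ns`. -/
def FunSound {n : ℕ} (f : List.Vector ℕ n → ℕ) (v : Fin n → DVar) (y : DVar) (δ : DEnv D)
    (t : Trace D) : Prop :=
  ∀ z e S, δ 0 = some z → δ 1 = some e → IsSucc z S → (∀ x y, Edge z e t x y → S x y) →
    ∀ ns : List.Vector ℕ n, (∀ i, ∃ d, δ (v i) = some d ∧ Rep z S (ns.get i) d) →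
      ∃ d, δ y = some d ∧ Rep z S (f ns) d

/-- At each of the first `B + 1` positions, the trace is still before the first `e`, and it will
show the pairs `(ν b, ν (b + 1))` with `b < B` before the first `e`. -/
def Rich (ν : ℕ → D) (e : D) (t : Trace D) (B : ℕ) : Prop :=
  ∀ j ≤ B, t j ≠ e ∧ ∀ b < B, Edge (ν 0) e (t.drop j) (ν b) (ν (b + 1))

theorem Rich.mono {ν : ℕ → D} {e : D} {t : Trace D} {B B' : ℕ} (h : Rich ν e t B) (hB : B' ≤ B) :
    Rich ν e t B' :=
  fun j hj => ⟨(h j (hj.trans hB)).1, fun b hb => (h j (hj.trans hB)).2 b (hb.trans_le hB)⟩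

theorem Rich.drop {ν : ℕ → D} {e : D} {t : Trace D} {B : ℕ} (h : Rich ν e t (B + 1)) :
    Rich ν e (t.drop 1) B := fun j hj => by
  have := h (j + 1) (by omega)
  rw [Trace.drop_drop, Nat.add_comm 1 j]
  exact ⟨this.1, fun b hb => this.2 b (by omega)⟩

/-- The registers `v` contain the numbers `ns`, the register `y` contains `f ns`, numbers being
coded by `ν`, and the trace is sufficiently rich. -/
def FunComplete {n : ℕ} (f B : List.Vector ℕ n → ℕ) (v : Fin n → DVar) (y : DVar) (δ : DEnv D)
    (t : Trace D) : Prop :=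
  ∃ (ν : ℕ → D) (e : D) (ns : List.Vector ℕ n), δ 0 = some (ν 0) ∧ δ 1 = some e ∧
    Rich ν e t (B ns) ∧ (∀ i, δ (v i) = some (ν (ns.get i))) ∧ δ y = some (ν (f ns))

/-- The registers a formula for `y = f v` may use. -/
def funRegs {n : ℕ} (v : Fin n → DVar) (y : DVar) : Finset DVar :=
  {0, 1, y} ∪ Finset.univ.image v

/-- The graph of `f` is definable, with input and output registers of our choice. -/
def FunDefinable (D : Type*) {n : ℕ} (f : List.Vector ℕ n → ℕ) : Prop :=
  ∃ B : List.Vector ℕ n → ℕ, ∀ (v : Fin n → DVar) (y : DVar),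
    Definable (D := D) (funRegs v y) (FunSound f v y) (FunComplete f B v y)

theorem FunDefinable.zero : FunDefinable D (n := 0) fun _ => 0 := by
  refine ⟨fun _ => 0, fun v y => (Definable.eq 0 y).mono ?_ ?_ ?_⟩
  · intro x
    simp [funRegs]
    tauto
  · intro δ t h z e S hz he hS ht ns hns
    exact ⟨z, by rw [← h, hz], rfl⟩
  · rintro δ t ⟨ν, e, ns, hz, he, -, -, h⟩
    rw [hz, h]

theorem FunDefinable.get {n : ℕ} (i : Fin n) : FunDefinable D fun v => v.get i := by
  refine ⟨fun _ => 0, fun v y => (Definable.eq (v i) y).mono ?_ ?_ ?_⟩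
  · intro x
    simp only [funRegs, Finset.mem_insert, Finset.mem_singleton, Finset.mem_union,
      Finset.mem_image, Finset.mem_univ, true_and]
    rintro (rfl | rfl)
    exacts [Or.inr ⟨i, rfl⟩, Or.inl (Or.inr (Or.inr rfl))]
  · intro δ t h z e S hz he hS ht ns hns
    rw [← h]
    exact hns i
  · rintro δ t ⟨ν, e, ns, hz, he, -, hv, h⟩
    rw [hv, h]

theorem FunDefinable.succ : FunDefinable D (n := 1) fun v => Nat.succ v.head := by
  refine ⟨fun v => v.head + 1, fun v y => (Definable.edge (v 0) y).mono ?_ ?_ ?_⟩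
  · intro x
    simp [funRegs]
    tauto
  · intro δ t h z e S hz he hS ht ns hns
    obtain ⟨x, y, hx, hy, hxy⟩ := h z e hz he
    obtain ⟨d, hd, hr⟩ := hns 0
    rw [List.Vector.get_zero] at hr
    obtain rfl : x = d := by simpa [hx] using hd
    exact ⟨y, hy, x, hr, ht _ _ hxy⟩
  · rintro δ t ⟨ν, e, ns, hz, he, hB, hv, h⟩
    refine ⟨⟨_, _, hz, he⟩, fun z' e' hz' he' => ?_⟩
    obtain rfl : ν 0 = z' := by simpa [hz] using hz'
    obtain rfl : e = e' := by simpa [he] using he'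
    refine ⟨_, _, hv 0, h, ?_⟩
    rw [List.Vector.get_zero]
    exact (hB 0 (Nat.zero_le _)).2 _ (Nat.lt_succ_self _)

/-- The intermediate results are guessed into fresh registers `s + i`, above all registers in use.
They are all checked on the same trace, so the required richness is a maximum. -/
theorem FunDefinable.comp {m n : ℕ} {f : List.Vector ℕ n → ℕ} {g : Fin n → List.Vector ℕ m → ℕ}
    (hf : FunDefinable D f) (hg : ∀ i, FunDefinable D (g i)) :
    FunDefinable D fun a => f (List.Vector.ofFn fun i => g i a) := by
  obtain ⟨Bf, hf⟩ := hf
  choose Bg hg using hg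
  refine ⟨fun a => max (Bf (List.Vector.ofFn fun i => g i a)) (Finset.univ.sup fun i => Bg i a),
    fun v y => ?_⟩
  obtain ⟨s, hs⟩ : ∃ s, ∀ x ∈ funRegs v y, x < s :=
    ⟨(funRegs v y).sup id + 1, fun x hx => Nat.lt_succ_of_le (Finset.le_sup (f := id) hx)⟩
  have hv : ∀ i, v i ∈ funRegs v y := fun i => by simp [funRegs]
  have hy : y ∈ funRegs v y := by simp [funRegs]
  have h0 : 0 ∈ funRegs v y := by simp [funRegs]
  have h1 : 1 ∈ funRegs v y := by simp [funRegs]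
  let w : Fin n → DVar := fun i => s + i
  have hw : ∀ x ∈ funRegs v y, x ∉ (List.finRange n).map w := by
    intro x hx hx'
    simp only [List.mem_map, List.mem_finRange, true_and] at hx'
    obtain ⟨i, rfl⟩ := hx'
    exact absurd (hs _ hx) (Nat.not_lt.2 (Nat.le_add_right s i))
  have hwm : ∀ i, w i ∈ (List.finRange n).map w := fun i =>
    List.mem_map.2 ⟨i, List.mem_finRange i, rfl⟩
  set V := ((List.finRange n).map w).toFinset ∪ funRegs v y with hV
  have hfV : funRegs w y ⊆ V := by
    intro x
    simp [funRegs, hV]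
    tauto
  have hgV : ∀ i, funRegs v (w i) ⊆ V := by
    intro i x
    have := hwm i
    simp only [funRegs, hV, Finset.mem_union, Finset.mem_insert, Finset.mem_singleton,
      List.mem_toFinset]
    rintro ((h | h | rfl) | h) <;> tauto
  have key := Definable.exList ((List.finRange n).map w)
    (((hf w y).mono hfV (fun _ _ h => h) (fun _ _ h => h)).conj
    (Definable.conjList (List.finRange n) fun i _ =>
      (hg i v (w i)).mono (hgV i) (fun _ _ h => h) (fun _ _ h => h)))
  refine key.mono subset_rfl ?_ ?_
  · rintro δ t ⟨δ', h, h₁, h₂⟩ z e S hz he hS ht ns hns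
    have hz' := (h 0 (hw _ h0)).trans hz
    have he' := (h 1 (hw _ h1)).trans he
    rw [← h y (hw _ hy)]
    refine h₁ z e S hz' he' hS ht _ fun i => ?_
    rw [List.Vector.get_ofFn]
    refine h₂ i (List.mem_finRange i) z e S hz' he' hS ht ns fun j => ?_
    rw [h (v j) (hw _ (hv j))]
    exact hns j
  · rintro δ t ⟨ν, e, ns, hz, he, hB, hns, hr⟩
    let δ' : DEnv D := fun x => if hx : s ≤ x ∧ x - s < n then
      some (ν (g ⟨x - s, hx.2⟩ ns)) else δ x
    have hδ' : ∀ i, δ' (w i) = some (ν (g i ns)) := by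
      intro i
      simp [δ', w]
    have hδ : ∀ x ∉ (List.finRange n).map w, δ' x = δ x := by
      intro x hx
      refine dif_neg fun hx' => hx ?_
      exact List.mem_map.2 ⟨⟨x - s, hx'.2⟩, List.mem_finRange _, Nat.add_sub_cancel' hx'.1⟩
    have hz' := (hδ 0 (hw _ h0)).trans hz
    have he' := (hδ 1 (hw _ h1)).trans he
    refine ⟨δ', hδ, fun x hx => ?_, ⟨ν, e, _, hz', he', hB.mono (le_max_left _ _), fun i => ?_, ?_⟩,
      fun i _ => ⟨ν, e, ns, hz', he', hB.mono (le_trans ?_ (le_max_right _ _)), fun j => ?_, hδ' i⟩⟩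
    · obtain ⟨i, -, rfl⟩ := List.mem_map.1 hx
      rw [hδ']
      rfl
    · rw [hδ', List.Vector.get_ofFn]
    · rw [hδ y (hw _ hy), hr]
    · exact Finset.le_sup (f := fun i => Bg i ns) (Finset.mem_univ i)
    · rw [hδ _ (hw _ (hv j)), hns]

/-- The recursion runs downwards. Registers `a`, `r` hold a claim that the function has value `r` at
`a`. Unless `a` is zero, the predecessor `b` and the value `q` at `b` are guessed, `r = g (b, q, …)`
is checked, and the claim becomes `(b, q)`. -/
theorem FunDefinable.prec {n : ℕ} {f : List.Vector ℕ n → ℕ} {g : List.Vector ℕ (n + 2) → ℕ}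
    (hf : FunDefinable D f) (hg : FunDefinable D g) :
    FunDefinable D fun v : List.Vector ℕ (n + 1) =>
      v.head.rec (f v.tail) fun y IH => g (y ::ᵥ IH ::ᵥ v.tail) := by
  obtain ⟨Bf, hf⟩ := hf
  obtain ⟨Bg, hg⟩ := hg
  let F : List.Vector ℕ n → ℕ → ℕ := fun ns m => m.rec (f ns) fun y IH => g (y ::ᵥ IH ::ᵥ ns)
  -- The bound covers the evaluation of `g`, the recursive call, which starts one position later
  -- (hence `IH + 1`), and the pair of `y` and `y + 1`.
  let B : List.Vector ℕ n → ℕ → ℕ := fun ns m =>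
    m.rec (Bf ns) fun y IH => max (Bg (y ::ᵥ F ns y ::ᵥ ns)) (max (IH + 1) (y + 1))
  refine ⟨fun v => B v.tail v.head, fun v y => ?_⟩
  obtain ⟨s, hs⟩ : ∃ s : ℕ, ∀ x ∈ funRegs v y, x < s :=
    ⟨(funRegs v y).sup id + 1, fun x hx => Nat.lt_succ_of_le (Finset.le_sup (f := id) hx)⟩
  have hv : ∀ i, v i ∈ funRegs v y := fun i => by simp [funRegs]
  have hy : y ∈ funRegs v y := by simp [funRegs]
  have h0 : 0 ∈ funRegs v y := by simp [funRegs]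
  have h1 : 1 ∈ funRegs v y := by simp [funRegs]
  obtain ⟨a, ha⟩ : ∃ a, a = s := ⟨_, rfl⟩
  obtain ⟨r, hr⟩ : ∃ r, r = s + 1 := ⟨_, rfl⟩
  obtain ⟨b, hb⟩ : ∃ b, b = s + 2 := ⟨_, rfl⟩
  obtain ⟨q, hq⟩ : ∃ q, q = s + 3 := ⟨_, rfl⟩
  have hne : ∀ x ∈ funRegs v y, x ≠ a ∧ x ≠ r ∧ x ≠ b ∧ x ≠ q := by
    intro x hx
    have : (x : ℕ) < s := hs x hx
    rw [ha, hr, hb, hq]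
    exact ⟨this.ne, (this.trans_le (Nat.le_add_right _ _)).ne,
      (this.trans_le (Nat.le_add_right _ _)).ne, (this.trans_le (Nat.le_add_right _ _)).ne⟩
  have har : a ≠ r := by omega
  have hab : a ≠ b := by omega
  have haq : a ≠ q := by omega
  have hrb : r ≠ b := by omega
  have hrq : r ≠ q := by omega
  have hbq : b ≠ q := by omega
  clear ha hr hb hq hs
  let vt : Fin n → DVar := fun i => v i.succ
  let u : Fin (n + 2) → DVar := Fin.cons b (Fin.cons q vt)
  have hvt : ∀ i, vt i ∈ funRegs v y := fun i => hv _
  have d₁ : Definable (insert a (insert r (funRegs v y))) _ _ :=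
    ((Definable.eq a 0).mono (by intro x; simp [funRegs]; tauto) (fun _ _ h => h)
      (fun _ _ h => h)).conj ((hf vt r).mono (by
        intro x
        simp only [funRegs, Finset.mem_union, Finset.mem_insert, Finset.mem_singleton,
          Finset.mem_image, Finset.mem_univ, true_and]
        rintro ((h | h | h) | ⟨i, rfl⟩)
        · tauto
        · tauto
        · tauto
        · exact Or.inr (Or.inr (Or.inr ⟨i.succ, rfl⟩))) (fun _ _ h => h) (fun _ _ h => h))
  have d₂ : Definable (insert b (insert q (insert a (insert r (funRegs v y))))) _ _ :=
    (Definable.notEnd.mono (by intro x; simp [funRegs]; tauto) (fun _ _ h => h)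
      (fun _ _ h => h)).conj (((Definable.edge b a).mono (by intro x; simp [funRegs]; tauto)
      (fun _ _ h => h) (fun _ _ h => h)).conj ((hg u r).mono (by
        intro x
        simp only [funRegs, Finset.mem_union, Finset.mem_insert, Finset.mem_singleton,
          Finset.mem_image, Finset.mem_univ, true_and]
        rintro ((h | h | h) | ⟨i, rfl⟩)
        · tauto
        · tauto
        · tauto
        · refine Fin.cases ?_ (fun i => Fin.cases ?_ (fun i => ?_) i) i
          · simp [u]
          · simp [u]
          · simp [u, vt]) (fun _ _ h => h) (fun _ _ h => h)))
  have key := Definable.ex a (Definable.ex r (V := insert a (funRegs v y))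
    ((((Definable.eq a (v 0)).mono (by
      intro x
      simp only [Finset.mem_insert, Finset.mem_singleton]
      rintro (rfl | rfl)
      exacts [Or.inr (Or.inl rfl), Or.inr (Or.inr (hv 0))]) (fun _ _ h => h)
      (fun _ _ h => h)).conj ((Definable.eq r y).mono (by
        intro x
        simp only [Finset.mem_insert, Finset.mem_singleton]
        rintro (rfl | rfl)
        exacts [Or.inl rfl, Or.inr (Or.inr hy)]) (fun _ _ h => h) (fun _ _ h => h))).conj
    ((Definable.iter hab hbq haq hrq d₁ d₂).mono (Finset.insert_comm _ _ _).subset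
      (fun _ _ h => h) (fun _ _ h => h))))
  refine key.mono subset_rfl ?_ ?_
  · rintro δ t ⟨x, x', ⟨h₁, h₂⟩, h₃⟩ z e S hz he hS ht ns hns
    have upd : ∀ w ∈ funRegs v y,
        Function.update (Function.update δ a (some x)) r (some x') w = δ w := by
      intro w hw
      rw [Function.update_of_ne (hne w hw).2.1, Function.update_of_ne (hne w hw).1]
    -- Environment and trace vary along the recursion, while the relation `S` stays fixed and
    -- contains the pairs of every suffix reached.
    have hsound : ∀ (δ : DEnv D) t, Iter a r b q (fun δ t => δ a = δ 0 ∧ FunSound f vt r δ t)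
        (fun δ t => (∀ e, δ 1 = some e → t 0 ≠ e) ∧ EdgeReg b a δ t ∧ FunSound g u r δ t) δ t →
        δ 0 = some z → δ 1 = some e →
        (∀ x y, Edge z e t x y → S x y) →
        (∀ i, ∃ d, δ (vt i) = some d ∧ Rep z S (ns.tail.get i) d) →
        ∀ m d, δ a = some d → Rep z S m d → ∃ d', δ r = some d' ∧ Rep z S (F ns.tail m) d' := by
      intro δ t h
      induction h with
      | base h =>
        intro hz he ht hns m d hd hm
        have hdz : d = z := by
          have := h.1
          rw [hd, hz] at this
          exact Option.some.inj this
        cases m with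
        | zero => exact h.2 z e S hz he hS ht _ hns
        | succ m =>
          obtain ⟨_, _, h'⟩ := hm
          exact absurd hdz (hS.ne_zero h')
      | @step δ t d₁ d₂ h _ ih =>
        intro hz he ht hns m d hd hm
        obtain ⟨hE, hedge, hg⟩ := h
        have upd₁ : ∀ w, w ≠ b → w ≠ q →
            Function.update (Function.update δ b (some d₁)) q (some d₂) w = δ w := by
          intro w h h'
          rw [Function.update_of_ne h', Function.update_of_ne h]
        have z₁ := (upd₁ 0 (hne 0 h0).2.2.1 (hne 0 h0).2.2.2).trans hz
        have e₁ := (upd₁ 1 (hne 1 h1).2.2.1 (hne 1 h1).2.2.2).trans he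
        have upd₂ : ∀ w ∈ funRegs v y, Function.update (Function.update (Function.update
            (Function.update δ b (some d₁)) q (some d₂)) a (some d₁)) r (some d₂) w = δ w := by
          intro w hw
          rw [Function.update_of_ne (hne w hw).2.1, Function.update_of_ne (hne w hw).1,
            upd₁ w (hne w hw).2.2.1 (hne w hw).2.2.2]
        obtain ⟨x, x', hx, hx', hxx'⟩ := hedge z e z₁ e₁
        rw [Function.update_of_ne hbq, Function.update_self] at hx
        rw [upd₁ a hab haq, hd] at hx'
        obtain rfl : d₁ = x := Option.some.inj hx
        obtain rfl : d = x' := Option.some.inj hx'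
        have hS' := ht _ _ hxx'
        cases m with
        | zero => exact absurd hm (hS.ne_zero hS')
        | succ m =>
          obtain ⟨x, hxm, hxd⟩ := hm
          -- Injectivity of `S` identifies the guessed predecessor with the one that represents `m`.
          obtain rfl := hS.injective hxd hS'
          obtain ⟨d', hd', hr'⟩ := ih ((upd₂ 0 h0).trans hz) ((upd₂ 1 h1).trans he)
            (fun x y hxy => ht x y (hxy.of_drop fun j hj => by
              obtain rfl : j = 0 := by omega
              exact hE e e₁))
            (fun i => by rw [upd₂ _ (hvt i)]; exact hns i) m x
            (by rw [Function.update_of_ne har, Function.update_self]) hxm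
          rw [Function.update_self] at hd'
          obtain rfl : d₂ = d' := Option.some.inj hd'
          have := hg z e S z₁ e₁ hS ht (m ::ᵥ F ns.tail m ::ᵥ ns.tail) (by
            intro i
            refine Fin.cases ?_ (fun i => Fin.cases ?_ (fun i => ?_) i) i
            · refine ⟨x, ?_, hxm⟩
              simp [u, Function.update_of_ne hbq]
            · refine ⟨d₂, ?_, hr'⟩
              simp [u]
            · obtain ⟨d', h₁, h₂⟩ := hns i
              refine ⟨d', ?_, by simpa using h₂⟩
              simp only [u, Fin.cons_succ]
              rw [upd₁ _ (hne _ (hvt i)).2.2.1 (hne _ (hvt i)).2.2.2, h₁])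
          rwa [upd₁ r hrb hrq] at this
    obtain ⟨d, hd, hm⟩ := hns 0
    obtain ⟨d', hd', h'⟩ := hsound _ _ h₃ ((upd 0 h0).trans hz) ((upd 1 h1).trans he) ht (fun i => by
      rw [upd _ (hvt i)]
      simpa using hns i.succ) ns.head d (by rw [h₁, upd _ (hv 0), hd]) (by simpa using hm)
    exact ⟨d', by rw [← upd y hy, ← h₂, hd'], h'⟩
  · rintro δ t ⟨ν, e, ns, hz, he, hB, hns, hr⟩
    have upd : ∀ w ∈ funRegs v y, Function.update (Function.update δ a (some (ν ns.head))) r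
        (some (ν (F ns.tail ns.head))) w = δ w := by
      intro w hw
      rw [Function.update_of_ne (hne w hw).2.1, Function.update_of_ne (hne w hw).1]
    have hcomplete : ∀ m (δ : DEnv D) t, δ 0 = some (ν 0) → δ 1 = some e →
        (∀ i, δ (vt i) = some (ν (ns.tail.get i))) → Rich ν e t (B ns.tail m) →
        δ a = some (ν m) → δ r = some (ν (F ns.tail m)) → Iter a r b q
          (fun δ t => δ a = δ 0 ∧ FunComplete f Bf vt r δ t)
          (fun δ t => (∃ e, δ 1 = some e ∧ t 0 ≠ e) ∧ (HasEnds δ ∧ EdgeReg b a δ t) ∧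
            FunComplete g Bg u r δ t) δ t := by
      intro m
      induction m with
      | zero =>
        intro δ t hz he hns hB ha hr
        exact .base ⟨ha.trans hz.symm, ν, e, ns.tail, hz, he, hB, hns, hr⟩
      | succ m ih =>
        intro δ t hz he hns hB ha hr
        have upd₁ : ∀ w, w ≠ b → w ≠ q → Function.update (Function.update δ b (some (ν m))) q
            (some (ν (F ns.tail m))) w = δ w := by
          intro w h h'
          rw [Function.update_of_ne h', Function.update_of_ne h]
        have z₁ := (upd₁ 0 (hne 0 h0).2.2.1 (hne 0 h0).2.2.2).trans hz
        have e₁ := (upd₁ 1 (hne 1 h1).2.2.1 (hne 1 h1).2.2.2).trans he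
        have upd₂ : ∀ w ∈ funRegs v y, Function.update (Function.update (Function.update
            (Function.update δ b (some (ν m))) q (some (ν (F ns.tail m)))) a (some (ν m))) r
            (some (ν (F ns.tail m))) w = δ w := by
          intro w hw
          rw [Function.update_of_ne (hne w hw).2.1, Function.update_of_ne (hne w hw).1,
            upd₁ w (hne w hw).2.2.1 (hne w hw).2.2.2]
        have hBm : m + 1 ≤ B ns.tail (m + 1) :=
          (le_max_right _ _).trans (le_max_right _ _)
        refine .step (ν m) (ν (F ns.tail m)) ⟨⟨e, e₁, (hB 0 (Nat.zero_le _)).1⟩,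
          ⟨⟨_, _, z₁, e₁⟩, fun z' e' hz' he' => ?_⟩, ν, e, m ::ᵥ F ns.tail m ::ᵥ ns.tail, z₁, e₁,
          hB.mono (le_max_left _ _), fun i => ?_, ?_⟩
          (ih _ _ ((upd₂ 0 h0).trans hz) ((upd₂ 1 h1).trans he)
            (fun i => (upd₂ _ (hvt i)).trans (hns i))
            (hB.mono ((le_max_left _ _).trans (le_max_right _ _))).drop ?_ ?_)
        · obtain rfl : ν 0 = z' := Option.some.inj (z₁.symm.trans hz')
          obtain rfl : e = e' := Option.some.inj (e₁.symm.trans he')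
          refine ⟨ν m, ν (m + 1), ?_, ?_, (hB 0 (Nat.zero_le _)).2 m hBm⟩
          · rw [Function.update_of_ne hbq, Function.update_self]
          · rw [upd₁ a hab haq, ha]
        · refine Fin.cases ?_ (fun i => Fin.cases ?_ (fun i => ?_) i) i
          · simp [u, Function.update_of_ne hbq]
          · simp only [u, Fin.cons_succ, Fin.cons_zero, Function.update_self]
            rfl
          · simp only [u, Fin.cons_succ]
            rw [upd₁ _ (hne _ (hvt i)).2.2.1 (hne _ (hvt i)).2.2.2, hns i]
            simp
        · rw [upd₁ r hrb hrq, hr]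
        · rw [Function.update_of_ne har, Function.update_self]
        · rw [Function.update_self]
    refine ⟨_, _, ⟨?_, ?_⟩, hcomplete ns.head _ t ((upd 0 h0).trans hz) ((upd 1 h1).trans he)
      (fun i => ?_) hB ?_ ?_⟩
    · rw [upd _ (hv 0), hns, Function.update_of_ne har, Function.update_self, List.Vector.get_zero]
    · rw [upd y hy, hr, Function.update_self]
    · rw [upd _ (hvt i), hns]
      simp
    · rw [Function.update_of_ne har, Function.update_self]
    · rw [Function.update_self]

/-- The graphs of the primitive recursive functions are definable. -/
theorem FunDefinable.of_primrec {n : ℕ} {f : List.Vector ℕ n → ℕ} (hf : Nat.Primrec' f) :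
    FunDefinable D f := by
  induction hf with
  | zero => exact FunDefinable.zero
  | succ => exact FunDefinable.succ
  | get i => exact FunDefinable.get i
  | comp g _ _ hf hg => exact FunDefinable.comp hf hg
  | prec _ _ hf hg => exact FunDefinable.prec hf hg

/-! ### Expressing that a trace is a correct successor table. -/

/-- Up to the first `e`, the consecutive pairs of `t` are compatible with `y` being the successor
of `x`. -/
def Consistent (z e x y : D) (t : Trace D) : Prop :=
  ∃ L, (∀ j < L, t j ≠ e ∧ (t (j + 1) ≠ z → t (j + 1) ≠ e → y ≠ z → (t j = x ↔ t (j + 1) = y))) ∧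
    t L = e

/-- Up to the first `e`, which exists, the consecutive pairs of `t` are compatible with each
other. -/
def Valid (z e : D) (t : Trace D) : Prop :=
  ∃ L, (∀ i < L, t i ≠ e ∧ Consistent z e (t i) (t (i + 1)) (t.drop (i + 1))) ∧ t L = e

/-- The constraint on the next action saying that it and the previous action, kept in register `4`,
are compatible with the pair in the registers `2` and `3`. -/
def BExp.compatible : BExp :=
  .neg (.conj .notZero (.conj .notEnd (.conj (.neg (.eq (.var 3) (.var 0)))
    (.neg (.conj (.neg (.conj (.eq (.var 4) (.var 2)) (.neg (.eq .star (.var 3)))))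
      (.neg (.conj (.neg (.eq (.var 4) (.var 2))) (.eq .star (.var 3)))))))))

theorem BExp.compatible_holds {δ : DEnv D} {z e x y w d : D} (hz : δ 0 = some z)
    (he : δ 1 = some e) (hx : δ 2 = some x) (hy : δ 3 = some y) (hw : δ 4 = some w) :
    BExp.compatible.Holds δ d ↔ (d ≠ z → d ≠ e → y ≠ z → (w = x ↔ d = y)) := by
  simp only [BExp.compatible, BExp.Holds, Exp.val, BExp.notZero_holds hz, BExp.notEnd_holds he,
    hz, hx, hy, hw, Option.some.injEq]
  tauto

/-- The constraint saying that the current action is in register `x`. -/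
def BExp.here (x : DVar) : BExp := .eq .star (.var x)

theorem BExp.here_holds {δ : DEnv D} {x : DVar} {d : D} :
    (BExp.here x).Holds δ d ↔ δ x = some d :=
  eq_comm

/-- Constraints see one action only, so register `4` stores the current value for comparison with
the next. -/
theorem Definable.consistent : Definable {0, 1, 2, 3}
    (fun (δ : DEnv D) t => ∀ z e x y, δ 0 = some z → δ 1 = some e → δ 2 = some x → δ 3 = some y →
      Consistent z e x y t)
    (fun δ t => ∃ z e x y, δ 0 = some z ∧ δ 1 = some e ∧ δ 2 = some x ∧ δ 3 = some y ∧
      Consistent z e x y t) := by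
  have h : Definable (D := D) {0, 1, 2, 3} _ _ :=
    ((Definable.test BExp.notEnd (V := {0, 1, 2, 3}) (by decide)).conj
      (((Definable.test BExp.compatible (V := {4, 0, 1, 2, 3}) (by decide)).pos (.here 4)
        (by decide)).ex 4)).eventually
      (Definable.test (BExp.here 1) (by decide))
  have upd : ∀ (δ : DEnv D) (d : Option D) (w : DVar), w ≠ 4 → Function.update δ 4 d w = δ w :=
    fun δ d w h => Function.update_of_ne h _ _
  refine h.mono subset_rfl ?_ ?_
  · rintro δ t ⟨L, hL, hL'⟩ z e x y hz he hx hy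
    refine ⟨L, fun j hj => ?_, ?_⟩
    · obtain ⟨h₁, d, h₂, h₃⟩ := hL j hj
      rw [BExp.compatible_holds ((upd _ _ 0 (by decide)).trans hz)
        ((upd _ _ 1 (by decide)).trans he) ((upd _ _ 2 (by decide)).trans hx)
        ((upd _ _ 3 (by decide)).trans hy) (Function.update_self ..)] at h₃
      rw [BExp.here_holds, Function.update_self] at h₂
      rw [BExp.notEnd_holds he] at h₁
      rw [Option.some.inj h₂] at h₃
      simp only [Trace.drop_apply, Nat.zero_add, Nat.add_comm 1 j] at h₁ h₃
      exact ⟨h₁, h₃⟩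
    · rw [BExp.here_holds, he] at hL'
      simpa using (Option.some.inj hL').symm
  · rintro δ t ⟨z, e, x, y, hz, he, hx, hy, L, hL, hL'⟩
    refine ⟨L, fun j hj => ⟨?_, t j, ?_, ?_⟩, ?_⟩
    · rw [BExp.notEnd_holds he]
      simpa using (hL j hj).1
    · rw [BExp.here_holds, Function.update_self]
      simp
    · rw [BExp.compatible_holds ((upd _ _ 0 (by decide)).trans hz)
        ((upd _ _ 1 (by decide)).trans he) ((upd _ _ 2 (by decide)).trans hx)
        ((upd _ _ 3 (by decide)).trans hy) (Function.update_self ..)]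
      simpa [Nat.add_comm 1 j] using (hL j hj).2
    · rw [BExp.here_holds, he]
      simp [hL']

theorem Definable.valid : Definable {0, 1}
    (fun (δ : DEnv D) t => ∀ z e, δ 0 = some z → δ 1 = some e → Valid z e t)
    (fun δ t => ∃ z e, δ 0 = some z ∧ δ 1 = some e ∧ Valid z e t) := by
  have h : Definable (D := D) {0, 1} _ _ :=
    ((Definable.test BExp.notEnd (V := {0, 1}) (by decide)).conj
      ((((((Definable.test (BExp.here 3) (V := {3, 2, 0, 1}) (by decide)).conj
        (Definable.consistent.mono (by decide) (fun _ _ h => h) (fun _ _ h => h))).ex 3)).pos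
        (.here 2) (by decide)).ex 2)).eventually
      (Definable.test (BExp.here 1) (by decide))
  refine h.mono subset_rfl ?_ ?_
  · rintro δ t ⟨L, hL, hL'⟩ z e hz he
    refine ⟨L, fun j hj => ?_, ?_⟩
    · obtain ⟨h₁, x, h₂, y, h₃, h₄⟩ := hL j hj
      rw [BExp.here_holds, Function.update_self] at h₂ h₃
      rw [BExp.notEnd_holds he] at h₁
      have := h₄ z e x y hz he rfl rfl
      rw [Option.some.inj h₂, Option.some.inj h₃, Trace.drop_drop] at this
      simp only [Trace.drop_apply, Nat.zero_add] at h₁ this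
      exact ⟨h₁, this⟩
    · rw [BExp.here_holds, he] at hL'
      simpa using (Option.some.inj hL').symm
  · rintro δ t ⟨z, e, hz, he, L, hL, hL'⟩
    refine ⟨L, fun j hj => ⟨?_, t j, ?_, t (j + 1), ?_, z, e, t j, t (j + 1), hz, he, rfl, rfl, ?_⟩,
      ?_⟩
    · rw [BExp.notEnd_holds he]
      simpa using (hL j hj).1
    · rw [BExp.here_holds, Function.update_self]
      simp
    · rw [BExp.here_holds, Function.update_self]
      simp [Nat.add_comm 1 j]
    · rw [Trace.drop_drop]
      exact (hL j hj).2
    · rw [BExp.here_holds, he]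
      simp [hL']

/-- Of two pairs before the end marker, the earlier one is compared with the later one by its
`Consistent` condition. The first `e` lies beyond both, so the comparison does reach the later pair.
-/
theorem Valid.isSucc {z e : D} {t : Trace D} (h : Valid z e t) : IsSucc z (Edge z e t) := by
  obtain ⟨L, hL, hL'⟩ := h
  have key : ∀ i i', i ≤ i' → (∀ j ≤ i' + 1, t j ≠ e) → t (i + 1) ≠ z → t (i' + 1) ≠ z →
      (t i' = t i ↔ t (i' + 1) = t (i + 1)) := by
    intro i i' hi hj hz hz'
    rcases hi.eq_or_lt with rfl | hi
    · simp
    have hiL : i < L := by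
      by_contra hcon
      exact hj L (by omega) hL'
    obtain ⟨K, hK, hK'⟩ := (hL i hiL).2
    have hiK : i' - (i + 1) < K := by
      by_contra hcon
      exact hj (K + (i + 1)) (by omega) hK'
    have h := (hK _ hiK).2
    simp only [Trace.drop_apply, show i' - (i + 1) + 1 + (i + 1) = i' + 1 by omega,
      show i' - (i + 1) + (i + 1) = i' by omega] at h
    exact h hz' (hj _ le_rfl) hz
  refine ⟨?_, fun ⟨_, _, _, _, h⟩ => h⟩
  · rintro x x' y ⟨i, rfl, rfl, h₁, h₂⟩ ⟨i', rfl, h₃, h₄, h₅⟩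
    rcases le_total i i' with h | h
    · exact ((key i i' h h₄ h₂ (h₃ ▸ h₂)).2 h₃).symm
    · exact (key i' i h h₁ (h₃ ▸ h₂) h₂).2 h₃.symm

/-- Every value before the first `e` represents a number. -/
theorem exists_rep {z e : D} {t : Trace D} (h0 : t 0 = z) :
    ∀ i, (∀ j ≤ i, t j ≠ e) → ∃ m, Rep z (Edge z e t) m (t i)
  | 0, _ => ⟨0, h0⟩
  | i + 1, h => by
    obtain ⟨m, hm⟩ := exists_rep h0 i fun j hj => h j (by omega)
    by_cases hz : t (i + 1) = z
    · exact ⟨0, hz⟩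
    · exact ⟨m + 1, t i, hm, i, rfl, rfl, h, hz⟩

theorem rep_of_ne_zero {z e : D} {t : Trace D} (h0 : t 0 = z) :
    ∀ n, (∀ j ≤ n, t j ≠ e) → (∀ j < n, t (j + 1) ≠ z) → Rep z (Edge z e t) n (t n)
  | 0, _, _ => h0
  | n + 1, h, h' => ⟨t n, rep_of_ne_zero h0 n (fun j hj => h j (by omega))
      (fun j hj => h' j (by omega)), n, rfl, rfl, h, h' n n.lt_succ_self⟩

/-! ### The part of the formula that depends on `n`. -/

/-- The formula saying that `ψ` holds from position `n` on, and that the values up to that position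
are not the end marker and, after the first, not zero. -/
def Formula.afterSteps (ψ : Formula) : ℕ → Formula
  | 0 => ψ
  | n + 1 => .pos .notEnd (.conj (.pos (.conj .notEnd .notZero) .tt) (ψ.afterSteps n))

theorem Formula.Clean.afterSteps {V : Finset DVar} {k : ℕ} {ψ : Formula} (h : ψ.Clean V k)
    (hV : {0, 1} ⊆ V) (n : ℕ) : (ψ.afterSteps n).Clean V k := by
  induction n with
  | zero => exact h
  | succ n ih =>
    have h0 : 0 ∈ V := hV (by decide)
    have h1 : 1 ∈ V := hV (by decide)
    refine ⟨?_, by simp [Formula.afterSteps, Formula.freeRec, ih.freeRec],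
      ⟨trivial, ih.guarded⟩, ih.nodup, ih.le⟩
    have := ih.freeData
    intro x
    simp only [Formula.afterSteps, Formula.freeData, BExp.notEnd, BExp.notZero, BExp.vars,
      Exp.vars, Finset.mem_union, Finset.mem_singleton, Finset.notMem_empty]
    rintro ((h | rfl) | ((((h | rfl) | (h | rfl)) | h) | h))
    all_goals first | exact absurd h (by simp) | assumption | exact this h

theorem Formula.mem_den_afterSteps {ψ : Formula} {ρ : TEnv D} {δ : DEnv D} {z e : D}
    (hz : δ 0 = some z) (he : δ 1 = some e) (n : ℕ) (t : Trace D) :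
    t ∈ (ψ.afterSteps n).den ρ δ ↔
      (∀ j < n, t j ≠ e ∧ t (j + 1) ≠ e ∧ t (j + 1) ≠ z) ∧ t.drop n ∈ ψ.den ρ δ := by
  induction n generalizing t with
  | zero => simp [Formula.afterSteps, Trace.drop_zero]
  | succ n ih =>
    have : t ∈ (ψ.afterSteps (n + 1)).den ρ δ ↔
        t 0 ≠ e ∧ (t 1 ≠ e ∧ t 1 ≠ z) ∧ t.drop 1 ∈ (ψ.afterSteps n).den ρ δ := by
      simp only [Formula.afterSteps, Formula.den, Set.mem_ofPred_eq, Set.mem_inter_iff, BExp.Holds,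
        BExp.notEnd_holds he, BExp.notZero_holds hz, Set.mem_univ, and_true, Nat.zero_add]
      rfl
    rw [this, ih, Trace.drop_drop, Nat.add_comm 1 n]
    constructor
    · rintro ⟨h₁, h₂, h₃, h₄⟩
      refine ⟨fun j hj => ?_, h₄⟩
      cases j with
      | zero => exact ⟨h₁, h₂⟩
      | succ j => exact h₃ j (by omega)
    · rintro ⟨h₁, h₂⟩
      exact ⟨(h₁ 0 n.succ_pos).1, (h₁ 0 n.succ_pos).2, fun j hj => h₁ (j + 1) (by omega), h₂⟩

/-! ### The computable model: a trace of growing blocks. -/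

/-- One step of counting through blocks `0, 1, …, m`, with `m` growing from block to block. The
state consists of `m` and of the current number. -/
def blockStep (p : ℕ × ℕ) : ℕ × ℕ := if p.2 < p.1 then (p.1, p.2 + 1) else (p.1 + 1, 0)

/-- The sequence of numbers `0, …, n, 0, …, n + 1, 0, …, n + 2, …`. -/
def blocks (n j : ℕ) : ℕ := (blockStep^[j] (n, 0)).2

theorem blocks_succ (n j : ℕ) : blocks n (j + 1) = blocks n j + 1 ∨ blocks n (j + 1) = 0 := by
  simp only [blocks, Function.iterate_succ_apply', blockStep]
  split_ifs
  · exact Or.inl rfl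
  · exact Or.inr rfl

theorem iterate_blockStep {m c k : ℕ} (h : c + k ≤ m) : blockStep^[k] (m, c) = (m, c + k) := by
  induction k with
  | zero => rfl
  | succ k ih =>
    rw [Function.iterate_succ_apply', ih (by omega), blockStep, if_pos (by simp only; omega)]
    rfl

theorem blocks_of_le {n j : ℕ} (h : j ≤ n) : blocks n j = j := by
  rw [blocks, iterate_blockStep (by omega), Nat.zero_add]

theorem exists_iterate_blockStep (n j M : ℕ) :
    ∃ i, j ≤ i ∧ ∃ m, M ≤ m ∧ blockStep^[i] (n, 0) = (m, 0) := by
  have next : ∀ j m c, blockStep^[j] (n, 0) = (m, c) →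
      ∃ i, j ≤ i ∧ blockStep^[i] (n, 0) = (m + 1, 0) := by
    intro j m c h
    rcases le_total c m with hc | hc
    · refine ⟨(m - c) + j + 1, by omega, ?_⟩
      rw [Function.iterate_succ_apply', Function.iterate_add_apply, h,
        iterate_blockStep (by omega), blockStep, if_neg (by simp only; omega)]
    · refine ⟨j + 1, by omega, ?_⟩
      rw [Function.iterate_succ_apply', h, blockStep, if_neg (by simp only; omega)]
  induction M with
  | zero =>
    obtain ⟨i, hi, h⟩ := next j _ _ rfl
    exact ⟨i, hi, _, Nat.zero_le _, h⟩
  | succ M ih =>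
    obtain ⟨i, hi, m, hm, h⟩ := ih
    obtain ⟨i', hi', h'⟩ := next i _ _ h
    exact ⟨i', hi.trans hi', m + 1, by omega, h'⟩

theorem exists_blocks_eq (n j b : ℕ) :
    ∃ i, j ≤ i ∧ blocks n i = b ∧ blocks n (i + 1) = b + 1 := by
  obtain ⟨i, hi, m, hm, h⟩ := exists_iterate_blockStep n j (b + 1)
  refine ⟨b + i, by omega, ?_, ?_⟩
  · rw [blocks, Function.iterate_add_apply, h, iterate_blockStep (by omega), Nat.zero_add]
  · rw [blocks, Function.iterate_succ_apply', Function.iterate_add_apply, h,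
      iterate_blockStep (by omega), blockStep, if_pos (by simp only; omega), Nat.zero_add]

/-- The trace whose values code the numbers `blocks n`. -/
def blockTrace (ν : ℕ → D) (n : ℕ) : Trace D := fun j => ν (blocks n j)

/-- A step between entries either adds one or returns to zero, and pairs ending in zero are ignored.
Every code can serve as end marker, so the trace need not depend on the marker chosen later. -/
theorem blockTrace_valid {ν : ℕ → D} (hν : Function.Injective ν) (n E : ℕ) :
    Valid (ν 0) (ν E) (blockTrace ν n) := by
  classical
  have hex : ∃ L, blockTrace ν n L = ν E := by
    obtain ⟨i, -, h, -⟩ := exists_blocks_eq n 0 E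
    exact ⟨i, congrArg ν h⟩
  refine ⟨Nat.find hex, fun i hi => ⟨Nat.find_min hex hi, Nat.find hex - (i + 1),
    fun j hj => ⟨Nat.find_min hex (m := j + (i + 1)) (by omega), fun h₁ _ h₂ => ?_⟩, ?_⟩,
    Nat.find_spec hex⟩
  · simp only [Trace.drop_apply, blockTrace, hν.eq_iff, ne_eq,
      show j + 1 + (i + 1) = (j + (i + 1)) + 1 by omega] at h₁ h₂ ⊢
    have h₃ := (blocks_succ n (j + (i + 1))).resolve_right h₁
    have h₄ := (blocks_succ n i).resolve_right h₂
    omega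
  · rw [Trace.drop_apply, Nat.sub_add_cancel (by omega)]
    exact Nat.find_spec hex

/-- Each pair of `b` and `b + 1` recurs beyond every position. Finitely many occurrences are needed,
and `E` is taken larger than every number up to the last of them. -/
theorem blockTrace_rich {ν : ℕ → D} (hν : Function.Injective ν) (n B : ℕ) :
    ∃ E, E ≠ 0 ∧ (∀ j ≤ n, blockTrace ν n j ≠ ν E) ∧
      Rich ν (ν E) ((blockTrace ν n).drop n) B := by
  choose i hi hib hib' using exists_blocks_eq n
  obtain ⟨L, hL⟩ : ∃ L, ∀ j ≤ B, ∀ b < B, i (j + n) b ≤ L :=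
    ⟨(Finset.range (B + 1) ×ˢ Finset.range B).sup fun p => i (p.1 + n) p.2, fun j hj b hb =>
      Finset.le_sup (f := fun p : ℕ × ℕ => i (p.1 + n) p.2) (b := (j, b))
        (by simp only [Finset.mem_product, Finset.mem_range]; omega)⟩
  obtain ⟨E, hE⟩ : ∃ E, ∀ j ≤ L + B + n + 1, blocks n j < E :=
    ⟨(Finset.range (L + B + n + 2)).sup (blocks n) + 1, fun j hj => Nat.lt_succ_of_le
      (Finset.le_sup (f := blocks n) (by simp only [Finset.mem_range]; omega))⟩
  have hne : ∀ j ≤ L + B + n + 1, blockTrace ν n j ≠ ν E := fun j hj h =>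
    (hE j hj).ne (hν h)
  refine ⟨E, ?_, fun j hj => hne j (by omega), fun j hj => ⟨hne _ (by omega), fun b hb => ?_⟩⟩
  · have := hE 0 (by omega)
    omega
  · have h₁ := hi (j + n) b
    have h₂ := hL j hj b hb
    refine ⟨i (j + n) b - (j + n), ?_, ?_, fun k hk => hne _ ?_, fun h => ?_⟩
    · simp only [Trace.drop_apply, Nat.add_assoc, Nat.sub_add_cancel h₁]
      exact congrArg ν (hib _ _)
    · simp only [Trace.drop_apply, blockTrace]
      rw [show i (j + n) b - (j + n) + 1 + j + n = i (j + n) b + 1 by omega, hib']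
    · omega
    · exact absurd (hν h) (Nat.succ_ne_zero b)

/-! ### Reducing an existential statement to satisfiability. -/

/-- The formula `∃ z. ∃ e. φ ∧ ψ'`, where `ψ'` says that `ψ` holds from position `n` on. -/
def Formula.instanceAt (φ ψ : Formula) (n : ℕ) : Formula :=
  .ex 0 (.ex 1 (.conj φ (ψ.afterSteps n)))

/-- The formulae `φ` and `ψ` do not depend on `n`, which makes the family computable. In `ψ`,
register `2` holds the value at position `n` and register `3` the code of `k`; using the zero
register `0` as output expresses `h (n, k) = 0`. The code of `k` must occur before the end marker,
since an arbitrary value need not represent a number. -/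
theorem exists_formula {D : Type*} (ν : ℕ → D) (hν : Function.Injective ν)
    {h : List.Vector ℕ 2 → ℕ} (hh : Nat.Primrec' h) :
    ∃ φ ψ : Formula, ∀ n, (φ.instanceAt ψ n).WellFormed ∧
      (((φ.instanceAt ψ n).traces D).Nonempty → ∃ k, h (n ::ᵥ k ::ᵥ .nil) = 0) ∧
      ((∃ k, h (n ::ᵥ k ::ᵥ .nil) = 0) → blockTrace ν n ∈ (φ.instanceAt ψ n).traces D) := by
  obtain ⟨B, hB⟩ := FunDefinable.of_primrec (D := D) hh
  have hφ : Definable (D := D) {0, 1} _ _ :=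
    ((Definable.test (.neg (.eq (.var 0) (.var 1))) (by decide)).conj Definable.valid).conj
      (Definable.test (BExp.here 0) (by decide))
  have hψ : Definable (D := D) {0, 1} _ _ :=
    ((Definable.test (BExp.here 2) (by decide)).conj
      (((((Definable.test BExp.notEnd (by decide)).eventually
        ((Definable.test BExp.notEnd (by decide)).conj (Definable.test (BExp.here 3)
          (V := {3, 2, 0, 1}) (by decide)))).conj
        ((hB ![2, 3] 0).mono (by decide) (fun _ _ h => h) (fun _ _ h => h)))).ex 3)).ex 2
  obtain ⟨φ, hφ, hφ'⟩ := hφ 0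
  obtain ⟨k, -, hk⟩ := exists_forall_mem_lt φ.recBinders 0
  obtain ⟨ψ, hψ, hψ'⟩ := hψ k
  refine ⟨φ, ψ, fun n => ⟨?_, ?_, ?_⟩⟩
  · have hψn := hψ.afterSteps subset_rfl n
    refine ⟨?_, ?_, ⟨hφ.guarded, hψn.guarded⟩, hφ.nodup.append hψn.nodup fun X hX hX' =>
      absurd (hk X hX) (not_lt.2 (hψn.le X hX'))⟩
    · rw [← Finset.subset_empty]
      intro x hx
      have h₁ := hφ.freeData
      have h₂ := hψn.freeData
      simp only [Formula.instanceAt, Formula.freeData, Finset.mem_erase, Finset.mem_union] at hx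
      have : x ∈ ({0, 1} : Finset DVar) := hx.2.2.elim (fun h => h₁ h) (fun h => h₂ h)
      simp only [Finset.mem_insert, Finset.mem_singleton] at this
      tauto
    · simp [Formula.instanceAt, Formula.freeRec, hφ.freeRec, hψn.freeRec]
  · rintro ⟨t, ht⟩
    simp only [Formula.traces, Formula.instanceAt, Formula.den, Set.mem_iUnion] at ht
    obtain ⟨z, e, ht₁, ht₂⟩ := ht
    generalize hδ : (Function.update (Function.update (fun _ => none) 0 (some z)) 1 (some e) :
      DEnv D) = δ at ht₁ ht₂
    have hz : δ 0 = some z := by simp [← hδ]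
    have he : δ 1 = some e := by simp [← hδ]
    obtain ⟨⟨-, hv⟩, h0⟩ := (hφ' _ _ _).1 ht₁
    have hvalid := hv z e hz he
    have h0 : t 0 = z := by
      rw [BExp.here_holds, hz] at h0
      exact (Option.some.inj h0).symm
    rw [Formula.mem_den_afterSteps hz he] at ht₂
    obtain ⟨hn, x, hx, y, ⟨i, hi, hi', hy⟩, hf⟩ :=
      And.imp_right ((hψ' _ _ _).1) ht₂
    have upd : ∀ w : DVar, w ≠ 2 → w ≠ 3 →
        Function.update (Function.update δ 2 (some x)) 3 (some y) w = δ w := fun w h₂ h₃ => by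
      rw [Function.update_of_ne h₃, Function.update_of_ne h₂]
    have he' := (upd 1 (by decide) (by decide)).trans he
    have hz' := (upd 0 (by decide) (by decide)).trans hz
    have hlt : ∀ j ≤ i + n, t j ≠ e := by
      intro j hj
      rcases lt_or_ge j n with h | h
      · exact (hn j h).1
      rcases lt_or_ge j (i + n) with h' | h'
      · have := hi (j - n) (by omega)
        rw [BExp.notEnd_holds he'] at this
        simpa [Nat.sub_add_cancel h] using this
      · rw [BExp.notEnd_holds he'] at hi'
        obtain rfl : j = i + n := by omega
        simpa using hi'
    rw [BExp.here_holds, Function.update_self] at hx hy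
    obtain rfl : x = t n := by simpa using hx
    obtain rfl : y = t (i + n) := by simpa using hy
    obtain ⟨k, hk⟩ := exists_rep h0 (i + n) hlt
    have hxn := rep_of_ne_zero h0 n (fun j hj => hlt j (by omega)) (fun j hj => (hn j hj).2.2)
    -- The formula for `h` is evaluated on the suffix from `n`, but with the successor relation of
    -- the whole trace, in which the value at `n` represents `n`.
    obtain ⟨d, hd, hd'⟩ := hf z e (Edge z e t) hz' he' hvalid.isSucc
      (fun x y h => h.of_drop fun j hj => (hn j hj).1) (n ::ᵥ k ::ᵥ .nil) (by
        intro i'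
        refine Fin.cases ?_ (fun i' => Fin.cases ?_ (fun i' => i'.elim0) i') i'
        · exact ⟨t n, by simp, hxn⟩
        · exact ⟨t (i + n), by simp, hk⟩)
    rw [hz'] at hd
    obtain rfl := Option.some.inj hd
    refine ⟨k, ?_⟩
    cases hm : h (n ::ᵥ k ::ᵥ .nil) with
    | zero => rfl
    | succ m =>
      rw [hm] at hd'
      obtain ⟨_, _, h⟩ := hd'
      exact absurd rfl (hvalid.isSucc.ne_zero h)
  · rintro ⟨k, hk⟩
    -- Besides the richness needed to evaluate `h`, `k + 1` ensures that the code of `k` occurs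
    -- before the end marker.
    obtain ⟨E, hE, hn, hr⟩ := blockTrace_rich hν n (max (B (n ::ᵥ k ::ᵥ .nil)) (k + 1))
    simp only [Formula.traces, Formula.instanceAt, Formula.den, Set.mem_iUnion]
    refine ⟨ν 0, ν E, ?_⟩
    generalize hδ : (Function.update (Function.update (fun _ => none) 0 (some (ν 0))) 1
      (some (ν E)) : DEnv D) = δ
    have hz : δ 0 = some (ν 0) := by simp [← hδ]
    have he : δ 1 = some (ν E) := by simp [← hδ]
    refine ⟨(hφ' _ _ _).2 ⟨⟨?_, _, _, hz, he, blockTrace_valid hν n E⟩, ?_⟩, ?_⟩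
    · simp [BExp.Holds, Exp.val, hz, he, hν.eq_iff, hE.symm]
    · rw [BExp.here_holds, hz]
      rfl
    rw [Formula.mem_den_afterSteps hz he]
    refine ⟨fun j hj => ⟨hn j (by omega), hn _ (by omega), fun h => ?_⟩, (hψ' _ _ _).2
      ⟨ν n, ?_, ν k, ?_, ν, ν E, n ::ᵥ k ::ᵥ .nil, ?_, ?_, hr.mono (le_max_left _ _), ?_, ?_⟩⟩
    · have := hν h
      rw [blocks_of_le (by omega)] at this
      omega
    · rw [BExp.here_holds, Function.update_self]
      simp [blockTrace, blocks_of_le le_rfl]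
    · obtain ⟨i, h₁, -, h₂, -⟩ := (hr 0 (Nat.zero_le _)).2 k
        (k.lt_succ_self.trans_le (le_max_right _ _))
      rw [Trace.drop_zero] at h₁ h₂
      have he' : Function.update (Function.update δ 2 (some (ν n))) 3 (some (ν k)) 1 =
        some (ν E) := by simp [he]
      refine ⟨i, fun j hj => ?_, ?_, ?_⟩
      · rw [BExp.notEnd_holds he']
        simpa using h₂ j (by omega)
      · rw [BExp.notEnd_holds he']
        simpa using h₂ i (by omega)
      · rw [BExp.here_holds, Function.update_self, ← h₁]
        simp
    · simp [hz]
    · simp [he]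
    · intro i
      refine Fin.cases ?_ (fun i => Fin.cases ?_ (fun i => i.elim0) i) i
      · simp
      · simp only [Fin.succ_zero_eq_one, Matrix.cons_val_one, Matrix.cons_val_fin_one,
          Function.update_self]
        rfl
    · simp [hz, hk]

/-! ### Computability of the reduction. -/

theorem primrec_num_instanceAt (φ ψ : Formula) : Primrec fun n => (φ.instanceAt ψ n).num := by
  have h : Primrec fun n => (ψ.afterSteps n).num := by
    refine (Primrec.nat_rec₁ ψ.num (f := fun _ m => Nat.pair 1 (Nat.pair BExp.notEnd.num (Nat.pair 4
      (Nat.pair (Formula.pos (.conj .notEnd .notZero) .tt).num m)))) ?_).of_eq fun n => ?_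
    · exact Primrec₂.natPair.comp₂ (.const _) (Primrec₂.natPair.comp₂ (.const _)
        (Primrec₂.natPair.comp₂ (.const _) (Primrec₂.natPair.comp₂ (.const _) Primrec₂.right)))
    · induction n with
      | zero => rfl
      | succ n ih =>
        simp only [Formula.afterSteps, Formula.num] at ih ⊢
        rw [← ih]
  have pair : ∀ (a : ℕ) {f : ℕ → ℕ}, Primrec f → Primrec fun n => Nat.pair a (f n) :=
    fun a f hf => Primrec₂.natPair.comp (.const a) hf
  exact pair 2 (pair 0 (pair 2 (pair 1 (pair 4 (pair φ.num h)))))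

theorem primrec_blocks : Primrec₂ blocks := by
  have h : Primrec blockStep :=
    Primrec.ite (Primrec.nat_lt.comp Primrec.snd Primrec.fst)
      (Primrec.fst.pair (Primrec.succ.comp Primrec.snd))
      ((Primrec.succ.comp Primrec.fst).pair (.const 0))
  exact Primrec.snd.comp (Primrec.nat_iterate Primrec.snd (Primrec.fst.pair (.const 0))
    (h.comp₂ Primrec₂.right))

/-- Prefixes of the block trace can thus be computed as lists of numbers, without computing in `D`.
-/
theorem encode_map_ofNat (D : Type*) [Denumerable D] (l : List ℕ) :
    Encodable.encode (l.map (Denumerable.ofNat D)) = Encodable.encode l := by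
  induction l with
  | nil => rfl
  | cons a l ih => simp [ih]

theorem primrec_encode_initSeg (D : Type*) [Denumerable D] : Primrec₂ fun n j =>
    Encodable.encode (initSeg (blockTrace (Denumerable.ofNat D) n) j) := by
  refine (Primrec.encode.comp ((Primrec.list_map (Primrec.list_range.comp Primrec.snd)
    (primrec_blocks.comp₂ (Primrec.fst.comp₂ Primrec₂.left) Primrec₂.right)))).of_eq fun p => ?_
  rw [← encode_map_ofNat D, List.map_map]
  rfl

open Nat.Partrec (Code) in
/-- It is recursively enumerable whether the program `f c` exists and outputs `0` on some initial
segment of the trace `blockTrace` for the number of `c`. -/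
theorem rePred_rejects (D : Type*) [Denumerable D] {f : Code →. Code} (hf : Partrec f) :
    REPred fun c => ∃ p ∈ f c, ∃ j, 0 ∈ p.eval (Encodable.encode
      (initSeg (blockTrace (Denumerable.ofNat D) (Encodable.encode c)) j)) := by
  let w : Code → ℕ → ℕ := fun c j => Encodable.encode
    (initSeg (blockTrace (Denumerable.ofNat D) (Encodable.encode c)) j)
  have hw : Primrec₂ w := (primrec_encode_initSeg D).comp₂
    (Primrec.encode.comp₂ Primrec₂.left) Primrec₂.right
  -- The search runs over pairs `s` of an evaluation bound and a prefix length, so that divergence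
  -- on one prefix does not block the others.
  let g : Code × Code → ℕ → Bool := fun q s =>
    decide (Code.evaln s.unpair.1 q.2 (w q.1 s.unpair.2) = some 0)
  have hg : Primrec₂ g := by
    have h : Primrec fun x : (Code × Code) × ℕ =>
        Code.evaln x.2.unpair.1 x.1.2 (w x.1.1 x.2.unpair.2) :=
      Code.primrec_evaln.comp ((((Primrec.fst.comp Primrec.unpair).comp Primrec.snd).pair
        (Primrec.snd.comp Primrec.fst)).pair (hw.comp (Primrec.fst.comp Primrec.fst)
          ((Primrec.snd.comp Primrec.unpair).comp Primrec.snd)))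
    exact (Primrec.eq.comp h (.const (some 0))).decide
  have key : Partrec fun c => (f c).bind fun p => Nat.rfind fun s => Part.some (g (c, p) s) :=
    hf.bind (Partrec.rfind hg.to_comp.partrec₂)
  refine key.dom_re.of_eq fun c => ?_
  constructor
  · intro h
    obtain ⟨x, hx⟩ := Part.dom_iff_mem.1 h
    obtain ⟨p, hp, hx⟩ := Part.mem_bind_iff.1 hx
    have := Nat.rfind_spec hx
    simp only [Part.mem_some_iff, g] at this
    exact ⟨p, hp, x.unpair.2, Code.evaln_sound (of_decide_eq_true this.symm)⟩
  · rintro ⟨p, hp, j, hj⟩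
    obtain ⟨k, hk⟩ := Code.evaln_complete.1 hj
    refine Part.dom_iff_mem.2 ?_
    have : (Nat.rfind fun s => Part.some (g (c, p) s)).Dom := by
      refine Nat.rfind_dom.2 ⟨Nat.pair k j, ?_, fun _ => trivial⟩
      simpa [g] using hk
    obtain ⟨x, hx⟩ := Part.dom_iff_mem.1 this
    exact ⟨x, Part.mem_bind hp hx⟩

open Nat.Partrec (Code) in
theorem exists_primrec_halting : ∃ h : List.Vector ℕ 2 → ℕ, Nat.Primrec' h ∧
    ∀ c : Code, (∃ k, h (Encodable.encode c ::ᵥ k ::ᵥ .nil) = 0) ↔ (c.eval 0).Dom := by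
  refine ⟨fun v => if (Code.evaln v.tail.head (Denumerable.ofNat Code v.head) 0).isSome then 0
    else 1, Nat.Primrec'.of_prim ?_, fun c => ?_⟩
  · have : Primrec fun v : List.Vector ℕ 2 =>
        Code.evaln v.tail.head (Denumerable.ofNat Code v.head) 0 :=
      Code.primrec_evaln.comp (((Primrec.vector_head.comp Primrec.vector_tail).pair
        ((Primrec.ofNat Code).comp Primrec.vector_head)).pair (.const 0))
    exact (Primrec.cond (Primrec.option_isSome.comp this) (.const 0) (.const 1)).of_eq fun v => by
      cases (Code.evaln v.tail.head (Denumerable.ofNat Code v.head) 0).isSome <;> rfl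
  · simp only [List.Vector.head_cons, List.Vector.tail_cons, Denumerable.ofNat_encode,
      ite_eq_left_iff, one_ne_zero, imp_false, not_not, Option.isSome_iff_exists]
    rw [Part.dom_iff_mem]
    constructor
    · rintro ⟨k, x, hx⟩
      exact ⟨x, Code.evaln_sound hx⟩
    · rintro ⟨x, hx⟩
      obtain ⟨k, hk⟩ := Code.evaln_complete.1 hx
      exact ⟨k, x, hk⟩

/-! ### The contradiction with the halting problem. -/

/-- Monitors that are sound for violations, and that reject every trace when the formula is
unsatisfiable, cannot be constructed effectively. -/
theorem not_effectivelyConstructible (D : Type*) [Denumerable D]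
    {P : Monitor D → Set (Trace D) → Prop} (hsound : ∀ m T, P m T → m.SoundForViolations T)
    (hempty : ∀ m, P m ∅ → ∀ t, m.Rejects t) : ¬ EffectivelyConstructible D P := by
  rintro ⟨f, hf, hfP⟩
  obtain ⟨h, hh, hhalt⟩ := exists_primrec_halting
  have hν : Function.Injective (Denumerable.ofNat D) :=
    Function.LeftInverse.injective (g := Encodable.encode) Denumerable.encode_ofNat
  obtain ⟨φ, ψ, hφ⟩ := exists_formula (Denumerable.ofNat D) hν hh
  have hF : Partrec fun c : Nat.Partrec.Code => f (φ.instanceAt ψ (Encodable.encode c)).num :=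
    hf.comp ((primrec_num_instanceAt φ ψ).comp Primrec.encode).to_comp
  refine ComputablePred.halting_problem_not_re 0 ((rePred_rejects D hF).of_eq fun c => ?_)
  obtain ⟨hwf, hsat, hmem⟩ := hφ (Encodable.encode c)
  obtain ⟨p, hp, m, hm, hP⟩ := hfP _ hwf
  rw [← hhalt c]
  constructor
  · rintro ⟨p', hp', j, hj⟩ hk
    rw [Part.mem_unique hp' hp] at hj
    exact hsound _ _ hP _ ⟨j, (hm _).2.2 hj⟩ (hmem hk)
  · intro hk
    have hT : (φ.instanceAt ψ (Encodable.encode c)).traces D = ∅ :=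
      Set.not_nonempty_iff_eq_empty.1 (mt hsat hk)
    rw [hT] at hP
    obtain ⟨j, hj⟩ := hempty m hP (blockTrace (Denumerable.ofNat D) (Encodable.encode c))
    exact ⟨p, hp, j, (hm _).2.1 hj⟩

end CHMLd

/-- When no trace satisfies the formula, the empty word is already a bad prefix, and `rejectAll` is
a sound competitor. Either kind of optimality therefore forces rejection of every trace. -/
theorem mainTheorem10 (D : Type*) [Denumerable D] :
    ¬ CHMLd.EffectivelyConstructible D CHMLd.Monitor.ViolationOptimal ∧
    ∀ Mon : Set (CHMLd.Monitor D), CHMLd.Monitor.rejectAll D ∈ Mon →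
      ¬ CHMLd.EffectivelyConstructible D
        (fun m T => CHMLd.Monitor.OptimalForViolationsIn Mon m T) := by
  refine ⟨CHMLd.not_effectivelyConstructible D (fun m T h => h.1) fun m h t => ?_,
    fun Mon hMon => CHMLd.not_effectivelyConstructible D (fun m T h => h.2.1) fun m h t => ?_⟩
  · exact ⟨0, h.2 _ fun _ _ => Set.notMem_empty _⟩
  · exact h.2.2 _ hMon (fun _ _ => Set.notMem_empty _) t ⟨0, trivial⟩
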